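/- **Setting.** Let $N\ge 3$, $2^*=2N/(N-2)$, $\beta=2^*/2-1$, and fix exponents $2\le q<2N/(N-2)$ and $2N/[2N-q(N-2)]\le p<\infty$. Let $a=(a_{ij}):\mathbb R\to\mathbb R^{N\times N}$ and $F:\mathbb R\times\mathbb R^N\times\mathbb R\to\mathbb R$ satisfy: * **(H1)** $a(\tau)$ is symmetric, $\nu_0|\xi|^2\le\sum_{ij}a_{ij}(\tau)\xi_i\xi_j\le\nu_0^{-1}|\xi|^2$ for all $\tau,\xi$ (with $\nu_0>0$), and $|a_{ij}(\tau_1)-a_{ij}(\tau_2)|\le C|\tau_1-\tau_2|^\theta$ for some $C>0$, $0<\theta<1$; * **(H2)** $F$ is continuous and $F(\tau,\cdot,0)\in L^2(\mathbb R^N)$ for every $\tau$; * **(H3)** $F(\tau,x,\cdot)$ is $C^1$ and $|F'_u(\tau,x,u)|\le C(1+|u|^\beta)$; * **(H4)** $|F(\tau_1,x,u)-F(\tau_2,x,u)|\le C(g_0(x)+|u|+|u|^{\beta+1})|\tau_1-\tau_2|^\theta$ for some $0<\theta<1$, $C>0$, $g_0\in L^2(\mathbb R^N)$; * **(AP)**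 $\tau\mapsto a(\tau)\in\mathcal M_1$ and $\tau\mapsto F(\tau,\cdot,\cdot)\in\mathcal M_2$ are (Bohr) almost-periodic. Here $\mathcal M_1$ is the space of real $N\times N$ matrices, and $\mathcal M_2$ is the space of functions $f(x,u)$, measurable in $x$ and $C^1$ in $u$, with finite norm $\|f\|_{\mathcal M_2}=\|f(\cdot,0)\|_{L^2}+\sup_{x,u}(1+|u|^\beta)^{-1}|f'_u(x,u)|$; * **(D)** $F(\tau,x,u)u\le-\nu|u|^2+b(\tau,x)|u|^q+c(\tau,x)$ for all $(\tau,x,u)$, where $\nu>0$ and $\tau\mapsto b(\tau,\cdot)\in L^p(\mathbb R^N)$, $\tau\mapsto c(\tau,\cdot)\in L^1(\mathbb R^N)$ are almost-periodic. Let $\bar a$, $\bar F$ be the mean values of $a$ and $F$, i.e. the limits as $T\to\infty$ of $\frac1{2T}\int_{-T}^T$ in $\mathcal M_1$ and $\mathcal M_2$. Let $\Sigma$ be the hull of $(a,F)$, i.e. the closure of the set of translates $\{(a,F)(\cdot+h):h\in\mathbb R\}$ for uniform convergence on $\mathbb R$ with values in $\mathcal M_1\times\mathcal M_2$. For $\lambda\in[0,1]$,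 $\omega>0$ and $\sigma=(\alpha,\Phi)\in\Sigma$ put $\alpha_{ij}(\lambda,\tau)=\lambda\alpha_{ij}(\tau)+(1-\lambda)\bar a_{ij}$ and $\Phi(\lambda,\tau,x,u)=\lambda\Phi(\tau,x,u)+(1-\lambda)\bar F(x,u)$. A solution on $[s,s+T]$, $T>0$, of the $(\lambda,\omega,\sigma)$-problem $$u_t-\sum_{i,j}\alpha_{ij}(\lambda,\omega t)\,\partial_i\partial_j u=\Phi(\lambda,\omega t,x,u)$$ is a function $u\in C^0([s,s+T],H^1(\mathbb R^N))\cap C^1((s,s+T),L^2(\mathbb R^N))$ such that for $t\in(s,s+T)$ one has $u(t)\in H^2(\mathbb R^N)$ and the equation holds in $L^2(\mathbb R^N)$. The norm of $H^1$ is $\|u\|_{H^1}^2=\|u\|_{L^2}^2+\sum_i\|\partial_iu\|_{L^2}^2$. A *decay rate* of $(b,c)$ is a sequence of positive numbers $m_k\to0$ with $$\int_{|x|\ge k}|b(\tau,x)|^p\,dx+\int_{|x|\ge k}|c(\tau,x)|\,dx\le m_k\qquad\text{for all }\tau\in\mathbb R,\ k\in\mathbb N.$$ **Proposition 3.2.**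 Let $N,p,q$ be fixed as above. 1. Every pair of almost-periodic functions $b:\mathbb R\to L^p(\mathbb R^N)$, $c:\mathbb R\to L^1(\mathbb R^N)$ has a decay rate. 2. For all $R,\nu,\nu_0>0$ and every sequence $(m_k)_{k\in\mathbb N}$ of positive numbers with $m_k\to0$ there is a sequence $(\eta_k)_{k\in\mathbb N}$ with $\eta_k\to0$, depending only on $R$, $\nu$, $\nu_0$ and $(m_k)_k$ (and on $N,p,q$), such that the following holds. Whenever $a$ and $F$ satisfy (H1)–(H4), (AP) and (D) with these constants $\nu_0,\nu$ and with $b,c$ having the decay rate $(m_k)$, and $\lambda\in[0,1]$, $\omega>0$, $\sigma\in\Sigma$, and $u$ is a solution of the $(\lambda,\omega,\sigma)$-problem on $[s,s+T]$ with $\|u(t)\|_{H^1}\le R$ for all $t\in[s,s+T]$, then $$\int_{|x|\ge k}|u(t,x)|^2\,dx\le R^2e^{-2\nu(t-s)}+\eta_k\qquad\text{for all }t\in[s,s+T],\ k\in\mathbb N.$$ -/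

import Mathlib

open MeasureTheory Filter Topology Set
open scoped ENNReal

namespace APParabolic

noncomputable section

/-- Euclidean space `ℝ^N`. -/
abbrev E (N : ℕ) := EuclideanSpace ℝ (Fin N)

/-- Real `L²(ℝ^N)`. -/
abbrev L2 (N : ℕ) := Lp ℝ 2 (volume : Measure (E N))

/-- Matrices of coefficients (an `N × N` array with the sup distance). -/
abbrev M1 (N : ℕ) := Fin N → Fin N → ℝ

/-! ### Sobolev spaces -/

section Sobolev

open scoped ContDiff

/-- `g` is the weak partial derivative `∂ᵢ f` (both in `L²`), tested against `C_c^∞`. -/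
def IsWeakPartial {N : ℕ} (i : Fin N) (f g : L2 N) : Prop :=
  ∀ φ : E N → ℝ, ContDiff ℝ ∞ φ → HasCompactSupport φ →
    ∫ x, f x * fderiv ℝ φ x (EuclideanSpace.single i 1) = - ∫ x, g x * φ x

lemma integrable_L2_mul {N : ℕ} (f : L2 N) {ψ : E N → ℝ} (hψ : Continuous ψ)
    (hc : HasCompactSupport ψ) : Integrable (fun x => f x * ψ x) :=
  (Lp.memLp f).integrable_mul (q := 2) (hψ.memLp_of_hasCompactSupport hc)

lemma continuous_partial {N : ℕ} (i : Fin N) {φ : E N → ℝ} (hφ : ContDiff ℝ ∞ φ) :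
    Continuous (fun x => fderiv ℝ φ x (EuclideanSpace.single i 1)) :=
  (hφ.continuous_fderiv (by simp)).clm_apply continuous_const

lemma hasCompactSupport_partial {N : ℕ} (i : Fin N) {φ : E N → ℝ} (hc : HasCompactSupport φ) :
    HasCompactSupport (fun x => fderiv ℝ φ x (EuclideanSpace.single i 1)) :=
  hc.fderiv_apply ℝ _

/-- The Hilbert space `H¹(ℝ^N)`, realised as the space of pairs `(u, ∇u)` in
`L² × (L²)^N` with `∇u` the weak gradient of `u`. It carries the norm
`‖u‖²_{H¹} = ‖u‖²_{L²} + ∑ᵢ ‖∂ᵢ u‖²_{L²}`. -/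
def H1 (N : ℕ) : Submodule ℝ (WithLp 2 (L2 N × PiLp 2 (fun _ : Fin N => L2 N))) where
  carrier := {z | ∀ i, IsWeakPartial i z.fst (z.snd i)}
  zero_mem' := by
    intro i φ _ _
    have h0 : ∀ᵐ x, (0 : L2 N) x = 0 := Lp.coeFn_zero ℝ 2 (volume : Measure (E N))
    have key : ∀ ψ : E N → ℝ, ∫ x, (0 : L2 N) x * ψ x = 0 := fun ψ => by
      refine integral_eq_zero_of_ae ?_
      filter_upwards [h0] with x hx
      rw [hx]; exact zero_mul _
    exact (key _).trans (by rw [neg_eq_zero.mpr]; exact key _)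
  add_mem' := by
    intro z w hz hw i φ hφ hc
    have key : ∀ (f g : L2 N) {ψ : E N → ℝ}, Continuous ψ → HasCompactSupport ψ →
        ∫ x, (f + g : L2 N) x * ψ x = (∫ x, f x * ψ x) + ∫ x, g x * ψ x := by
      intro f g ψ h1 h2
      rw [← integral_add (integrable_L2_mul f h1 h2) (integrable_L2_mul g h1 h2)]
      refine integral_congr_ae ?_
      filter_upwards [Lp.coeFn_add f g] with x hx
      rw [hx]; exact add_mul _ _ _
    have e1 := key z.fst w.fst (continuous_partial i hφ) (hasCompactSupport_partial i hc)
    have e2 := key (z.snd i) (w.snd i) hφ.continuous hc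
    have := hz i φ hφ hc
    have := hw i φ hφ hc
    simp only [WithLp.add_fst, WithLp.add_snd, PiLp.add_apply]
    linarith
  smul_mem' := by
    intro r z hz i φ hφ hc
    have key : ∀ (f : L2 N) (ψ : E N → ℝ),
        ∫ x, (r • f : L2 N) x * ψ x = r * ∫ x, f x * ψ x := by
      intro f ψ
      rw [← integral_const_mul]
      refine integral_congr_ae ?_
      filter_upwards [Lp.coeFn_smul r f] with x hx
      rw [hx]; exact mul_assoc _ _ _
    have := hz i φ hφ hc
    simp only [WithLp.smul_fst, WithLp.smul_snd, PiLp.smul_apply, key]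
    rw [this]; ring

/-- The `L²` function underlying an element of `H¹`. -/
def toL2 {N : ℕ} (u : H1 N) : L2 N := u.1.fst

/-- The weak partial derivative `∂ᵢ u` of an element of `H¹`. -/
def grad {N : ℕ} (u : H1 N) (i : Fin N) : L2 N := u.1.snd i

end Sobolev

/-! ### Almost-periodic functions -/

/-- Bohr almost-periodicity of `f : ℝ → X` for a distance `d` on `X`: `f` is continuous and for
every `ε > 0` the set of `ε`-almost-periods is relatively dense. -/
def AlmostPeriodic {X : Type*} (d : X → X → ℝ≥0∞) (f : ℝ → X) : Prop :=
  (∀ τ₀, Tendsto (fun τ => d (f τ) (f τ₀)) (𝓝 τ₀) (𝓝 0)) ∧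
  ∀ ε : ℝ≥0∞, 0 < ε → ∃ L : ℝ, 0 < L ∧ ∀ y : ℝ, ∃ h ∈ Icc y (y + L),
    ∀ τ, d (f (τ + h)) (f τ) ≤ ε

/-- The `L^p(ℝ^N)` distance of two functions. -/
def distLp {N : ℕ} (p : ℝ) (f g : E N → ℝ) : ℝ≥0∞ :=
  eLpNorm (fun x => f x - g x) (ENNReal.ofReal p) volume

/-! ### The space `M₂` of nonlinearities -/

/-- The critical growth exponent `β = 2^*/2 - 1`, where `2^* = 2N/(N-2)`. -/
def betaExp (N : ℕ) : ℝ := (2 * N / (N - 2)) / 2 - 1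

/-- The norm `‖f(·,0)‖_{L²} + sup_{x,u} (1+|u|^β)⁻¹ |f'_u(x,u)|` (with value `∞` allowed). -/
def m2Norm {N : ℕ} (f : E N → ℝ → ℝ) : ℝ≥0∞ :=
  eLpNorm (fun x => f x 0) 2 volume +
    ⨆ (x : E N) (u : ℝ), ENNReal.ofReal (|deriv (f x) u| / (1 + |u| ^ betaExp N))

/-- The distance given by `m2Norm`. -/
def m2Dist {N : ℕ} (f g : E N → ℝ → ℝ) : ℝ≥0∞ := m2Norm (fun x u => f x u - g x u)

/-- Membership in `M₂`: `f(x,u)` is measurable in `x` and `C¹` in `u`, `f(·,0) ∈ L²`, and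
`|f'_u| ≤ C (1+|u|^β)`. Only measurability in `x` is asked for, because the jointly continuous
functions of this kind are not complete for `m2Norm`; hulls and means are taken in this larger,
complete space. -/
structure IsM2 {N : ℕ} (f : E N → ℝ → ℝ) : Prop where
  meas : ∀ u, AEStronglyMeasurable (fun x => f x u) volume
  memLp : MemLp (fun x => f x 0) 2 volume
  contDiff : ∀ x, ContDiff ℝ 1 (f x)
  growth : ∃ C : ℝ, 0 < C ∧ ∀ x u, |deriv (f x) u| ≤ C * (1 + |u| ^ betaExp N)

/-! ### The standing assumptions -/

/-- Symmetry, uniform ellipticity with constant `ν₀`, and Hölder continuity of `a`. -/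
structure CondH1 {N : ℕ} (ν₀ : ℝ) (a : ℝ → M1 N) : Prop where
  symm : ∀ τ i j, a τ i j = a τ j i
  lower : ∀ (τ : ℝ) (ξ : E N), ν₀ * ‖ξ‖ ^ 2 ≤ ∑ i, ∑ j, a τ i j * ξ i * ξ j
  upper : ∀ (τ : ℝ) (ξ : E N), ∑ i, ∑ j, a τ i j * ξ i * ξ j ≤ ν₀⁻¹ * ‖ξ‖ ^ 2
  holder : ∃ θ C : ℝ, 0 < θ ∧ θ < 1 ∧ 0 < C ∧
    ∀ τ₁ τ₂ i j, |a τ₁ i j - a τ₂ i j| ≤ C * |τ₁ - τ₂| ^ θ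

/-- `F` is jointly continuous and `F(τ,·,0)` is square integrable. -/
structure CondH2 {N : ℕ} (F : ℝ → E N → ℝ → ℝ) : Prop where
  cont : Continuous (fun z : ℝ × E N × ℝ => F z.1 z.2.1 z.2.2)
  memLp : ∀ τ, MemLp (fun x => F τ x 0) 2 volume

/-- `F` is `C¹` in `u` with `|F'_u| ≤ C (1+|u|^β)`. -/
structure CondH3 {N : ℕ} (F : ℝ → E N → ℝ → ℝ) : Prop where
  contDiff : ∀ τ x, ContDiff ℝ 1 (F τ x)
  growth : ∃ C : ℝ, ∀ τ x u, |deriv (F τ x) u| ≤ C * (1 + |u| ^ betaExp N)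

/-- Hölder continuity of `F` in `τ`. -/
def CondH4 {N : ℕ} (F : ℝ → E N → ℝ → ℝ) : Prop :=
  ∃ (θ C : ℝ) (g₀ : E N → ℝ), 0 < θ ∧ θ < 1 ∧ 0 < C ∧ MemLp g₀ 2 volume ∧
    ∀ τ₁ τ₂ x u, |F τ₁ x u - F τ₂ x u| ≤
      C * (g₀ x + |u| + |u| ^ (betaExp N + 1)) * |τ₁ - τ₂| ^ θ

/-- `a` and `F` are almost-periodic with values in `M₁` and `M₂`. -/
def CondAP {N : ℕ} (a : ℝ → M1 N) (F : ℝ → E N → ℝ → ℝ) : Prop :=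
  AlmostPeriodic edist a ∧ AlmostPeriodic m2Dist F

/-- `τ ↦ b(τ,·) ∈ L^p` is almost-periodic. -/
def APLp {N : ℕ} (p : ℝ) (b : ℝ → E N → ℝ) : Prop :=
  (∀ τ, MemLp (b τ) (ENNReal.ofReal p) volume) ∧ AlmostPeriodic (distLp p) b

/-- Dissipativeness in the large, with rate `ν`, exponents `p`, `q` and coefficients `b`, `c`. -/
structure CondD {N : ℕ} (ν p q : ℝ) (F : ℝ → E N → ℝ → ℝ) (b c : ℝ → E N → ℝ) : Prop where
  ap_b : APLp p b
  ap_c : APLp 1 c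
  dissip : ∀ τ x u, F τ x u * u ≤ -ν * |u| ^ 2 + b τ x * |u| ^ q + c τ x

/-- `m` is a sequence of positive numbers, `m_k → 0`, which bounds the tails of `b` and `c`
uniformly in time. (Such a bound passes to the hulls and the means of `b` and `c`.) -/
structure TailRate {N : ℕ} (p : ℝ) (b c : ℝ → E N → ℝ) (m : ℕ → ℝ) : Prop where
  pos : ∀ k, 0 < m k
  tendsto : Tendsto m atTop (𝓝 0)
  tail : ∀ (τ : ℝ) (k : ℕ),
    (∫ x in {x : E N | (k : ℝ) ≤ ‖x‖}, |b τ x| ^ p) +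
      ∫ x in {x : E N | (k : ℝ) ≤ ‖x‖}, |c τ x| ≤ m k

/-! ### Mean values, hull, and the `(λ,ω,σ)`-problem -/

/-- `abar` is the mean value of `a` (entrywise). -/
def IsMeanM1 {N : ℕ} (a : ℝ → M1 N) (abar : M1 N) : Prop :=
  ∀ i j, Tendsto (fun T : ℝ => (2 * T)⁻¹ * ∫ τ in (-T)..T, a τ i j) atTop (𝓝 (abar i j))

/-- `Fbar ∈ M₂` is the mean value of `F`: the averages over `[-T,T]` tend to it in `M₂`. -/
def IsMeanM2 {N : ℕ} (F : ℝ → E N → ℝ → ℝ) (Fbar : E N → ℝ → ℝ) : Prop :=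
  IsM2 Fbar ∧
  Tendsto (fun T : ℝ => m2Dist (fun x u => (2 * T)⁻¹ * ∫ τ in (-T)..T, F τ x u) Fbar)
    atTop (𝓝 0)

/-- `(α,Φ)` lies in the hull `Σ` of `(a,F)`, the closure of the set of translates of `(a,F)`
for uniform convergence on `ℝ` with values in `M₁ × M₂`. -/
def InHull {N : ℕ} (a : ℝ → M1 N) (F : ℝ → E N → ℝ → ℝ)
    (α : ℝ → M1 N) (Φ : ℝ → E N → ℝ → ℝ) : Prop :=
  (∀ τ, IsM2 (Φ τ)) ∧
  ∀ ε : ℝ≥0∞, 0 < ε → ∃ h : ℝ, ∀ τ,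
    edist (α τ) (a (τ + h)) ≤ ε ∧ m2Dist (Φ τ) (F (τ + h)) ≤ ε

/-- `α(λ,τ) = λ α(τ) + (1-λ) abar`. -/
def homA {N : ℕ} (lam : ℝ) (α : ℝ → M1 N) (abar : M1 N) : ℝ → M1 N :=
  fun τ i j => lam * α τ i j + (1 - lam) * abar i j

/-- `Φ(λ,τ,x,u) = λ Φ(τ,x,u) + (1-λ) Fbar(x,u)`. -/
def homF {N : ℕ} (lam : ℝ) (Φ : ℝ → E N → ℝ → ℝ) (Fbar : E N → ℝ → ℝ) : ℝ → E N → ℝ → ℝ :=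
  fun τ x u => lam * Φ τ x u + (1 - lam) * Fbar x u

/-- `u` solves `u_t - ∑ A_ij(ωt) ∂ᵢ∂ⱼ u = G(ωt,x,u)` on `[s,s+T]`:
`u ∈ C⁰([s,s+T],H¹) ∩ C¹((s,s+T),L²)`, and for `t ∈ (s,s+T)` one has `u(t) ∈ H²` and the equation
holds in `L²`. Here `v` is the time derivative and `w i j` is `∂ⱼ∂ᵢ u(t)`. -/
structure IsSolution {N : ℕ} (A : ℝ → M1 N) (G : ℝ → E N → ℝ → ℝ) (ω s T : ℝ)
    (u : ℝ → H1 N) : Prop where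
  cont : ContinuousOn u (Icc s (s + T))
  eqn : ∃ v : ℝ → L2 N, ContinuousOn v (Ioo s (s + T)) ∧
    ∀ t ∈ Ioo s (s + T), HasDerivAt (fun r => toL2 (u r)) (v t) t ∧
      ∃ w : Fin N → Fin N → L2 N, (∀ i j, IsWeakPartial j (grad (u t) i) (w i j)) ∧
        ∀ᵐ x, v t x - ∑ i, ∑ j, A (ω * t) i j * w i j x = G (ω * t) x (toL2 (u t) x)

end

end APParabolic

/-!
Far from the origin the `L²` norm of a solution decays like `e^{-ν(t-s)}`, because only the tails
of `b` and `c` oppose the damping `-ν u²`. To see this, take a smooth weight `φ` which vanishes for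
`‖x‖ ≤ k/2` and equals `1` for `‖x‖ ≥ k`, and differentiate `y(t) = ∫ φ u(t)²`. The elliptic term
`∑ A_ij ∫ φ u ∂ᵢ∂ⱼu` is, after an integration by parts, nonpositive up to terms with `∇φ = O(1/k)`
(`sum_integral_weight_le`). The reaction term `∫ φ u F(τ,x,u)` is at most `-ν y` plus
`∫_{‖x‖ ≥ k/2} (|b| |u|^q + |c|)`, and Hölder's inequality bounds the latter by the decay rate and
the norm of `u` in `L^{qp'}`. The condition on `p` says `q p' ≤ 2^*`, so that the Sobolev inequality
controls this norm by `R` (`integral_mul_nonlinearity_le`). Gronwall's inequality for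
`y' ≤ -2ν y + o(1)` gives the claim (`IsSolution.weighted_energy_le`).

The nonlinearity in the equation is `λ Φ + (1-λ) F̄` with `Φ` in the hull and `F̄` the mean value of
`F`, and (D) is not assumed for these. But `Φ(τ)` is a limit in `M₂` of translates of `F`, and `F̄`
is one of time averages of `F`. The bound on `∫ φ u F(τ,x,u)` is uniform in `τ`, hence it holds for
the averages by Fubini's theorem, and convergence in `M₂` is strong enough to pass to the limit in
the integral (`exists_majorant_of_m2Norm_le`, `integral_mul_homF_le`). No compactness of the
translates of `b` and `c` is needed. The coefficient matrices stay in a closed convex set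
(`IsBddNonneg`).

The facts on `H¹` used here, integration by parts against an element of `H¹` and the Sobolev
inequality, both follow from the density of the test functions (`exists_test_approx`), which is
proved by cutting off and mollifying.

The existence of decay rates comes from the total boundedness of the range of an almost-periodic
function (`APLp.exists_finite_net`).
-/

namespace APParabolic

open scoped ContDiff Convolution

/-! ### Weak derivatives of functions -/

/-- `g` is the weak partial derivative `∂ᵢ f`. This is `IsWeakPartial` for functions instead of
classes in `L²`. -/
def HasWeakPartial {N : ℕ} (i : Fin N) (f g : E N → ℝ) : Prop :=
  ∀ φ : E N → ℝ, ContDiff ℝ ∞ φ → HasCompactSupport φ →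
    ∫ x, f x * fderiv ℝ φ x (EuclideanSpace.single i 1) = - ∫ x, g x * φ x

/-- The classical partial derivative `∂ᵢ φ`. -/
noncomputable def partialDeriv {N : ℕ} (i : Fin N) (φ : E N → ℝ) (x : E N) : ℝ :=
  fderiv ℝ φ x (EuclideanSpace.single i 1)

lemma integrable_mul_test {N : ℕ} {f ψ : E N → ℝ} (hf : MemLp f 2)
    (hψ : Continuous ψ) (hc : HasCompactSupport ψ) : Integrable (fun x => f x * ψ x) :=
  hf.integrable_mul (q := 2) (hψ.memLp_of_hasCompactSupport hc)

lemma contDiff_partialDeriv {N : ℕ} (i : Fin N) {φ : E N → ℝ} (hφ : ContDiff ℝ ∞ φ) :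
    ContDiff ℝ ∞ (partialDeriv i φ) :=
  (hφ.fderiv_right (m := ∞) le_rfl).clm_apply contDiff_const

lemma partialDeriv_mul {N : ℕ} (i : Fin N) {φ ψ : E N → ℝ} (hφ : ContDiff ℝ ∞ φ)
    (hψ : ContDiff ℝ ∞ ψ) (x : E N) :
    partialDeriv i (fun y => φ y * ψ y) x =
      φ x * partialDeriv i ψ x + ψ x * partialDeriv i φ x := by
  have h := ((hφ.differentiable (by simp)) x).hasFDerivAt.mul
    ((hψ.differentiable (by simp)) x).hasFDerivAt
  unfold partialDeriv
  have e : (fun y => φ y * ψ y) = φ * ψ := rfl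
  rw [e, h.fderiv]
  simp

/-- Leibniz rule for the product of a weakly differentiable and a smooth function. -/
lemma HasWeakPartial.smooth_mul {N : ℕ} {i : Fin N} {f g χ : E N → ℝ} (h : HasWeakPartial i f g)
    (hf : MemLp f 2) (hg : MemLp g 2) (hχ : ContDiff ℝ ∞ χ) :
    HasWeakPartial i (fun x => χ x * f x) (fun x => χ x * g x + partialDeriv i χ x * f x) := by
  intro ψ hψ hc
  have hcχ : HasCompactSupport (fun x => χ x * ψ x) := hc.mul_left
  have key := h (fun x => χ x * ψ x) (hχ.mul hψ) hcχ
  have hpψ : HasCompactSupport (partialDeriv i ψ) := hc.fderiv_apply ℝ _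
  have c1 : Continuous (partialDeriv i ψ) := (contDiff_partialDeriv i hψ).continuous
  have c2 : Continuous (partialDeriv i χ) := (contDiff_partialDeriv i hχ).continuous
  have i1 : Integrable (fun x => f x * (χ x * partialDeriv i ψ x)) :=
    integrable_mul_test hf (hχ.continuous.mul c1) hpψ.mul_left
  have i2 : Integrable (fun x => f x * (ψ x * partialDeriv i χ x)) :=
    integrable_mul_test hf (hψ.continuous.mul c2) hc.mul_right
  have i3 : Integrable (fun x => g x * (χ x * ψ x)) :=
    integrable_mul_test hg (hχ.continuous.mul hψ.continuous) hcχ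
  have e1 : ∫ x, f x * fderiv ℝ (fun x => χ x * ψ x) x (EuclideanSpace.single i 1) =
      (∫ x, f x * (χ x * partialDeriv i ψ x)) + ∫ x, f x * (ψ x * partialDeriv i χ x) := by
    rw [← integral_add i1 i2]
    congr 1 with x
    rw [← mul_add, ← partialDeriv_mul i hχ hψ]
    rfl
  have e2 : ∫ x, (χ x * g x + partialDeriv i χ x * f x) * ψ x =
      (∫ x, g x * (χ x * ψ x)) + ∫ x, f x * (ψ x * partialDeriv i χ x) := by
    rw [← integral_add i3 i2]
    congr 1 with x
    ring
  have e3 : ∫ x, χ x * f x * fderiv ℝ ψ x (EuclideanSpace.single i 1) =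
      ∫ x, f x * (χ x * partialDeriv i ψ x) := by
    congr 1 with x
    unfold partialDeriv
    ring
  rw [e3, e2]
  linarith

/-! ### Cutoff functions -/

/-- A smooth function equal to `1` on the unit ball and to `0` off the ball of radius `2`. -/
noncomputable def unitBump (N : ℕ) : ContDiffBump (0 : E N) := ⟨1, 2, one_pos, one_lt_two⟩

/-- The cutoff to the ball of radius `ρ`: equal to `1` for `‖x‖ ≤ ρ` and to `0` for
`2 ρ ≤ ‖x‖`. -/
noncomputable def cutoff (N : ℕ) (ρ : ℝ) (x : E N) : ℝ := unitBump N (ρ⁻¹ • x)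

lemma contDiff_cutoff (N : ℕ) (ρ : ℝ) : ContDiff ℝ ∞ (cutoff N ρ) :=
  (unitBump N).contDiff.comp (contDiff_const_smul _)

lemma cutoff_nonneg (N : ℕ) (ρ : ℝ) (x : E N) : 0 ≤ cutoff N ρ x := (unitBump N).nonneg

lemma cutoff_le_one (N : ℕ) (ρ : ℝ) (x : E N) : cutoff N ρ x ≤ 1 := (unitBump N).le_one

lemma cutoff_eq_one {N : ℕ} {ρ : ℝ} (hρ : 0 < ρ) {x : E N} (hx : ‖x‖ ≤ ρ) :
    cutoff N ρ x = 1 := by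
  refine (unitBump N).one_of_mem_closedBall ?_
  simp only [unitBump, mem_closedBall_zero_iff, norm_smul, norm_inv, Real.norm_eq_abs,
    abs_of_pos hρ]
  rw [inv_mul_le_iff₀ hρ]
  simpa using hx

lemma cutoff_eq_zero {N : ℕ} {ρ : ℝ} (hρ : 0 < ρ) {x : E N} (hx : 2 * ρ ≤ ‖x‖) :
    cutoff N ρ x = 0 := by
  refine (unitBump N).zero_of_le_dist ?_
  simp only [unitBump, dist_zero_right, norm_smul, norm_inv, Real.norm_eq_abs,
    abs_of_pos hρ]
  rw [le_inv_mul_iff₀ hρ]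
  linarith

lemma hasCompactSupport_cutoff (N : ℕ) {ρ : ℝ} (hρ : 0 < ρ) :
    HasCompactSupport (cutoff N ρ) := by
  refine HasCompactSupport.intro (isCompact_closedBall (0 : E N) (2 * ρ)) fun x hx => ?_
  refine cutoff_eq_zero hρ ?_
  simp only [mem_closedBall_zero_iff, not_le] at hx
  exact hx.le

lemma exists_partialDeriv_cutoff_le (N : ℕ) : ∃ C : ℝ, 0 < C ∧ ∀ (ρ : ℝ), 0 < ρ →
    ∀ (i : Fin N) (x : E N), |partialDeriv i (cutoff N ρ) x| ≤ C / ρ := by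
  have hs : ContDiff ℝ ∞ (unitBump N) := (unitBump N).contDiff
  obtain ⟨C, hC⟩ := ((unitBump N).hasCompactSupport.fderiv ℝ).exists_bound_of_continuous
    (hs.continuous_fderiv (by simp))
  refine ⟨max C 1, by positivity, fun ρ hρ i x => ?_⟩
  have h1 : HasFDerivAt (cutoff N ρ)
      ((fderiv ℝ (unitBump N) (ρ⁻¹ • x)).comp (ρ⁻¹ • ContinuousLinearMap.id ℝ (E N))) x :=
    ((hs.differentiable (by simp)) _).hasFDerivAt.comp x
      ((hasFDerivAt_id x).const_smul ρ⁻¹)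
  unfold partialDeriv
  rw [h1.fderiv]
  simp only [ContinuousLinearMap.comp_smul, ContinuousLinearMap.comp_id,
    smul_apply, smul_eq_mul, abs_mul, abs_inv, abs_of_pos hρ]
  rw [div_eq_inv_mul]
  gcongr
  calc |fderiv ℝ (unitBump N) (ρ⁻¹ • x) (EuclideanSpace.single i 1)|
      ≤ ‖fderiv ℝ (unitBump N) (ρ⁻¹ • x)‖ * ‖(EuclideanSpace.single i 1 : E N)‖ :=
        (fderiv ℝ (unitBump N) (ρ⁻¹ • x)).le_opNorm _
    _ = ‖fderiv ℝ (unitBump N) (ρ⁻¹ • x)‖ := by simp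
    _ ≤ C := hC _
    _ ≤ max C 1 := le_max_left _ _

/-! ### Tails of `L^p` functions -/

/-- The exterior of the ball of radius `ρ`. -/
def outer (N : ℕ) (ρ : ℝ) : Set (E N) := {x | ρ ≤ ‖x‖}

lemma measurableSet_outer (N : ℕ) (ρ : ℝ) : MeasurableSet (outer N ρ) :=
  (isClosed_le continuous_const continuous_norm).measurableSet

lemma tendsto_eLpNorm_outer {N : ℕ} {f : E N → ℝ} {p : ℝ≥0∞} (hp0 : p ≠ 0) (hp : p ≠ ⊤)
    (hf : MemLp f p) :
    Tendsto (fun k : ℕ => eLpNorm f p (volume.restrict (outer N k))) atTop (𝓝 0) := by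
  have hfin : ∫⁻ x, ‖f x‖ₑ ^ p.toReal ≠ ⊤ :=
    (lintegral_rpow_enorm_lt_top_of_eLpNorm_lt_top hp0 hp hf.2).ne
  have hlim : Tendsto (fun k : ℕ => ∫⁻ x in outer N k, ‖f x‖ₑ ^ p.toReal) atTop (𝓝 0) := by
    simp_rw [← lintegral_indicator (measurableSet_outer N _)]
    rw [← lintegral_zero (μ := (volume : Measure (E N)))]
    refine tendsto_lintegral_of_dominated_convergence' (fun x => ‖f x‖ₑ ^ p.toReal)
      (fun k => ((hf.1.enorm.pow_const _).indicator (measurableSet_outer N _)))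
      (fun k => Eventually.of_forall fun x => indicator_le_self _ _ _) hfin
      (Eventually.of_forall fun x => ?_)
    obtain ⟨n, hn⟩ := exists_nat_gt ‖x‖
    refine tendsto_const_nhds.congr' ?_
    filter_upwards [eventually_ge_atTop n] with k hk
    rw [indicator_of_notMem]
    simp only [outer, mem_ofPred_eq, not_le]
    exact hn.trans_le (by exact_mod_cast hk)
  have := (ENNReal.continuous_rpow_const (y := 1 / p.toReal)).tendsto 0 |>.comp hlim
  rw [ENNReal.zero_rpow_of_pos (one_div_pos.2 (ENNReal.toReal_pos hp0 hp))] at this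
  refine this.congr fun k => ?_
  rw [Function.comp_apply, eLpNorm_eq_lintegral_rpow_enorm_toReal hp0 hp]

/-! ### Mollification -/

/-- Mollification turns the weak derivative into a classical one: a translate of the reflected
mollifier is a test function. -/
lemma partialDeriv_mollify {N : ℕ} {i : Fin N} {f g : E N → ℝ} (h : HasWeakPartial i f g)
    (hf : LocallyIntegrable f) (φ : ContDiffBump (0 : E N)) (x : E N) :
    partialDeriv i (φ.normed volume ⋆[ContinuousLinearMap.lsmul ℝ ℝ, volume] f) x =
      (φ.normed volume ⋆[ContinuousLinearMap.lsmul ℝ ℝ, volume] g) x := by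
  set ρ : E N → ℝ := φ.normed volume with hρ
  have hsm : ContDiff ℝ ∞ ρ := φ.contDiff_normed
  have hc : HasCompactSupport ρ := φ.hasCompactSupport_normed
  have hd := hc.hasFDerivAt_convolution_left (ContinuousLinearMap.lsmul ℝ ℝ)
    (hsm.of_le (by simp)) hf x
  have e0 : partialDeriv i (ρ ⋆[ContinuousLinearMap.lsmul ℝ ℝ, volume] f) x =
      ∫ t, f t * partialDeriv i ρ (x - t) := by
    unfold partialDeriv
    rw [hd.fderiv, convolution_eq_swap, ContinuousLinearMap.integral_apply]
    · congr 1 with t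
      simp [ContinuousLinearMap.precompL_apply, mul_comm]
    · have := ((hc.fderiv ℝ).convolutionExists_left
        (L := (ContinuousLinearMap.lsmul ℝ ℝ : ℝ →L[ℝ] ℝ →L[ℝ] ℝ).precompL (E N))
        (hsm.continuous_fderiv (by simp)) hf x)
      exact this.integrable_swap
  have hψ : ContDiff ℝ ∞ (fun t => ρ (x - t)) := hsm.comp (contDiff_const.sub contDiff_id)
  have hψc : HasCompactSupport (fun t => ρ (x - t)) :=
    hc.comp_homeomorph (Homeomorph.subLeft x)
  have key := h _ hψ hψc
  have e1 : ∀ t, fderiv ℝ (fun t => ρ (x - t)) t (EuclideanSpace.single i 1) =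
      - partialDeriv i ρ (x - t) := by
    intro t
    have h2 : HasFDerivAt (fun t => ρ (x - t))
        ((fderiv ℝ ρ (x - t)).comp (-ContinuousLinearMap.id ℝ (E N))) t :=
      ((hsm.differentiable (by simp)) _).hasFDerivAt.comp t
        ((hasFDerivAt_id t).const_sub x)
    rw [h2.fderiv]
    simp [partialDeriv]
  simp only [e1, mul_neg, integral_neg] at key
  rw [e0, convolution_eq_swap]
  rw [neg_inj.1 key]
  congr 1 with t
  simp [mul_comm]

/-- The translates `y ↦ f(· - y)` of an `L²` function. -/
noncomputable def translate {N : ℕ} (f : L2 N) (y : E N) : L2 N :=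
  Lp.compMeasurePreserving (fun x => x - y) (measurePreserving_sub_right volume y) f

lemma continuous_translate {N : ℕ} (f : L2 N) : Continuous (translate f) := by
  let g : C(E N, C(E N, E N)) :=
    (ContinuousMap.mk (fun a : E N × E N => a.2 - a.1) (by fun_prop)).curry
  exact Continuous.compMeasurePreservingLp (f := fun _ : E N => f) continuous_const g.continuous
    (fun y => measurePreserving_sub_right volume y) (by simp)

lemma translate_zero {N : ℕ} (f : L2 N) : translate f 0 = f := by
  apply Lp.ext
  filter_upwards [Lp.coeFn_compMeasurePreserving f (measurePreserving_sub_right volume (0 : E N))]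
    with x hx
  rw [translate, hx]
  simp

/-- A mollification is an average of translates, as a Bochner integral in `L²`. -/
lemma integral_translate_ae_eq {N : ℕ} {f : E N → ℝ} (hf : MemLp f 2) (hi : Integrable f)
    (φ : ContDiffBump (0 : E N)) :
    (∫ y, φ.normed volume y • translate (hf.toLp f) y : L2 N) =ᵐ[volume]
      (φ.normed volume ⋆[ContinuousLinearMap.lsmul ℝ ℝ, volume] f) := by
  set ρ : E N → ℝ := φ.normed volume with hρ
  have hsm : ContDiff ℝ ∞ ρ := φ.contDiff_normed
  have hc : HasCompactSupport ρ := φ.hasCompactSupport_normed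
  have hconv : ContDiff ℝ ∞ (ρ ⋆[ContinuousLinearMap.lsmul ℝ ℝ, volume] f) :=
    hc.contDiff_convolution_left _ hsm hi.locallyIntegrable
  -- both sides have the same integral against test functions, by Fubini's theorem
  refine ae_eq_of_integral_contDiff_smul_eq ((Lp.memLp _).locallyIntegrable one_le_two)
    hconv.continuous.locallyIntegrable fun g hg hgc => ?_
  have hgL : MemLp g 2 := hg.continuous.memLp_of_hasCompactSupport hgc
  have hint : Integrable (fun y => ρ y • translate (hf.toLp f) y) :=
    (hsm.continuous.smul (continuous_translate _)).integrable_of_hasCompactSupport hc.smul_right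
  have inner_eq : ∀ z : L2 N, ∫ x, g x • z x = inner ℝ (hgL.toLp g) z := by
    intro z
    rw [L2.inner_def]
    refine integral_congr_ae ?_
    filter_upwards [hgL.coeFn_toLp] with x hx
    simp [hx, mul_comm]
  rw [inner_eq, ← innerSL_apply_apply ℝ, ← ContinuousLinearMap.integral_comp_comm _ hint]
  simp only [map_smul, innerSL_apply_apply]
  have e1 : ∀ y, ρ y • inner ℝ (hgL.toLp g) (translate (hf.toLp f) y) =
      ∫ x, g x * (ρ y * f (x - y)) := by
    intro y
    rw [← inner_eq, smul_eq_mul, ← integral_const_mul]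
    refine integral_congr_ae ?_
    have hq := (measurePreserving_sub_right (volume : Measure (E N)) y).quasiMeasurePreserving
    filter_upwards [Lp.coeFn_compMeasurePreserving (hf.toLp f)
      (measurePreserving_sub_right volume y), hq.ae hf.coeFn_toLp] with x hx hx'
    rw [translate, hx, Function.comp_apply, hx', smul_eq_mul]
    ring
  simp only [e1]
  rw [integral_integral_swap]
  · congr 1 with x
    rw [integral_const_mul]
    rfl
  · have h1 := (φ.integrable_normed (μ := volume)).convolution_integrand
      (ContinuousLinearMap.lsmul ℝ ℝ) hi
    obtain ⟨C, hC⟩ := hgc.exists_bound_of_continuous hg.continuous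
    have h2 := h1.swap.bdd_mul (c := C) (f := fun z : E N × E N => g z.2)
      (hg.continuous.comp continuous_snd).aestronglyMeasurable
      (Eventually.of_forall fun z => hC _)
    exact h2

/-- Mollifications converge in `L²`, by the continuity of translations. -/
lemma tendsto_mollify {N : ℕ} {f : E N → ℝ} (hf : MemLp f 2) (hi : Integrable f)
    {φ : ℕ → ContDiffBump (0 : E N)} (hφ : Tendsto (fun n => (φ n).rOut) atTop (𝓝 0)) :
    Tendsto (fun n => eLpNorm (fun x =>
      ((φ n).normed volume ⋆[ContinuousLinearMap.lsmul ℝ ℝ, volume] f) x - f x) 2)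
      atTop (𝓝 0) := by
  set F : L2 N := hf.toLp f with hF
  have hT := continuous_translate F
  have hmain : Tendsto (fun n => ∫ y, (φ n).normed volume y • translate F y) atTop (𝓝 F) := by
    rw [Metric.tendsto_atTop]
    intro ε hε
    have := Metric.continuousAt_iff.1 (hT.continuousAt (x := 0)) (ε / 2) (by positivity)
    obtain ⟨δ, hδ, hδ'⟩ := this
    obtain ⟨n₀, hn₀⟩ := (Metric.tendsto_atTop.1 hφ) δ hδ
    refine ⟨n₀, fun n hn => ?_⟩
    have hr : (φ n).rOut < δ := by
      have := hn₀ n hn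
      rw [Real.dist_0_eq_abs] at this
      exact (le_abs_self _).trans_lt this
    have hint : ∀ z : E N → L2 N, Continuous z →
        Integrable (fun y => (φ n).normed volume y • z y) := fun z hz =>
      ((φ n).continuous_normed.smul hz).integrable_of_hasCompactSupport
        (φ n).hasCompactSupport_normed.smul_right
    have e : (∫ y, (φ n).normed volume y • translate F y) - F =
        ∫ y, (φ n).normed volume y • (translate F y - F) := by
      simp only [smul_sub]
      rw [integral_sub (hint _ hT) (hint _ continuous_const), (φ n).integral_normed_smul]
    rw [dist_eq_norm, e]
    refine lt_of_le_of_lt (norm_integral_le_of_norm_le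
      (g := fun y => (φ n).normed volume y * (ε / 2)) ?_ (Eventually.of_forall fun y => ?_)) ?_
    · exact (φ n).integrable_normed.mul_const _
    · rw [norm_smul, Real.norm_of_nonneg ((φ n).nonneg_normed y)]
      by_cases hy : y ∈ Function.support ((φ n).normed volume)
      · refine mul_le_mul_of_nonneg_left ?_ ((φ n).nonneg_normed y)
        rw [(φ n).support_normed_eq] at hy
        have := hδ' (x := y) (lt_trans hy hr)
        rw [translate_zero, dist_eq_norm] at this
        exact this.le
      · rw [Function.notMem_support.1 hy]; simp
    · rw [integral_mul_const, (φ n).integral_normed]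
      linarith
  have h2 := tendsto_iff_edist_tendsto_0.1 hmain
  refine h2.congr fun n => ?_
  rw [Lp.edist_def]
  refine eLpNorm_congr_ae ?_
  filter_upwards [integral_translate_ae_eq hf hi (φ n), hf.coeFn_toLp] with x h1 h3
  simp only [Pi.sub_apply, hF]
  rw [h1, h3]

/-! ### Density of test functions in `H¹` -/

/-- Cutting off at a large radius is a small perturbation in `H¹`. -/
lemma tendsto_cutoff_mul {N : ℕ} {f : E N → ℝ} (hf : MemLp f 2) :
    Tendsto (fun n : ℕ => eLpNorm (fun x => cutoff N (n + 1 : ℝ) x * f x - f x) 2) atTop (𝓝 0) := by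
  refine tendsto_of_tendsto_of_tendsto_of_le_of_le tendsto_const_nhds
    (tendsto_eLpNorm_outer (by simp) (by simp) hf) (fun _ => zero_le) fun n => ?_
  rw [← eLpNorm_indicator_eq_eLpNorm_restrict (measurableSet_outer N n)]
  refine eLpNorm_mono fun x => ?_
  by_cases hx : x ∈ outer N n
  · rw [indicator_of_mem hx, ← sub_one_mul, norm_mul]
    refine mul_le_of_le_one_left (norm_nonneg _) ?_
    rw [Real.norm_eq_abs, abs_le]
    constructor <;> linarith [cutoff_nonneg N (n + 1) x, cutoff_le_one N (n + 1) x]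
  · have hx' : ‖x‖ ≤ n + 1 := by
      simp only [outer, mem_ofPred_eq, not_le] at hx
      linarith
    rw [indicator_of_notMem hx, cutoff_eq_one (by positivity) hx']
    simp

lemma tendsto_partialDeriv_cutoff_mul {N : ℕ} (i : Fin N) {f : E N → ℝ} (hf : MemLp f 2) :
    Tendsto (fun n : ℕ => eLpNorm (fun x => partialDeriv i (cutoff N (n + 1 : ℝ)) x * f x) 2)
      atTop (𝓝 0) := by
  obtain ⟨C, hC0, hC⟩ := exists_partialDeriv_cutoff_le N
  have h1 : Tendsto (fun n : ℕ => ENNReal.ofReal (C / ((n : ℝ) + 1)) * eLpNorm f 2)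
      atTop (𝓝 0) := by
    have h2 : Tendsto (fun n : ℕ => C / ((n : ℝ) + 1)) atTop (𝓝 0) :=
      tendsto_const_nhds.div_atTop (tendsto_natCast_atTop_atTop.atTop_add tendsto_const_nhds)
    have := ENNReal.Tendsto.mul_const (b := eLpNorm f 2 volume) (ENNReal.tendsto_ofReal h2)
      (Or.inr hf.2.ne)
    simpa using this
  refine tendsto_of_tendsto_of_tendsto_of_le_of_le tendsto_const_nhds h1
    (fun _ => zero_le) fun n => ?_
  refine eLpNorm_le_mul_eLpNorm_of_ae_le_mul (Eventually.of_forall fun x => ?_) 2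
  rw [norm_mul]
  gcongr
  exact hC _ (by positivity) i x

/-- A sequence of bump functions shrinking to the origin. -/
noncomputable def shrinkingBump (N n : ℕ) : ContDiffBump (0 : E N) :=
  ⟨1 / (n + 1 : ℝ) / 2, 1 / (n + 1 : ℝ), by positivity, half_lt_self (by positivity)⟩

lemma tendsto_shrinkingBump (N : ℕ) :
    Tendsto (fun n => (shrinkingBump N n).rOut) atTop (𝓝 0) :=
  tendsto_one_div_add_atTop_nhds_zero_nat

/-- Density of the test functions in `H¹`, for compactly supported functions: mollify. -/
lemma exists_test_approx_of_hasCompactSupport {N : ℕ} {f : E N → ℝ} {g : Fin N → E N → ℝ}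
    (hf : MemLp f 2) (hg : ∀ i, MemLp (g i) 2) (h : ∀ i, HasWeakPartial i f (g i))
    (hcf : HasCompactSupport f) (hcg : ∀ i, HasCompactSupport (g i)) {ε : ℝ≥0∞} (hε : 0 < ε) :
    ∃ ψ : E N → ℝ, ContDiff ℝ ∞ ψ ∧ HasCompactSupport ψ ∧
      eLpNorm (fun x => ψ x - f x) 2 ≤ ε ∧
      ∀ i, eLpNorm (fun x => partialDeriv i ψ x - g i x) 2 ≤ ε := by
  have hint : ∀ {u : E N → ℝ}, MemLp u 2 → HasCompactSupport u → Integrable u := by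
    intro u hu hc
    exact (integrableOn_iff_integrable_of_support_subset (subset_tsupport u)).1
      ((hu.locallyIntegrable one_le_two).integrableOn_isCompact hc)
  have e1 := (ENNReal.tendsto_nhds_zero.1
    (tendsto_mollify hf (hint hf hcf) (tendsto_shrinkingBump N))) ε hε
  have e2 : ∀ᶠ n in atTop, ∀ i, eLpNorm (fun x => ((shrinkingBump N n).normed volume
      ⋆[ContinuousLinearMap.lsmul ℝ ℝ, volume] g i) x - g i x) 2 ≤ ε :=
    eventually_all.2 fun i => (ENNReal.tendsto_nhds_zero.1
      (tendsto_mollify (hg i) (hint (hg i) (hcg i)) (tendsto_shrinkingBump N))) ε hε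
  obtain ⟨n, hn1, hn2⟩ := (e1.and e2).exists
  set φ := shrinkingBump N n
  have hfl := hf.locallyIntegrable one_le_two
  refine ⟨φ.normed volume ⋆[ContinuousLinearMap.lsmul ℝ ℝ, volume] f,
    φ.hasCompactSupport_normed.contDiff_convolution_left _ φ.contDiff_normed hfl,
    φ.hasCompactSupport_normed.convolution _ hcf, hn1, fun i => ?_⟩
  simp only [partialDeriv_mollify (h i) hfl]
  exact hn2 i

/-- Density of the test functions in `H¹`. -/
lemma exists_test_approx {N : ℕ} {f : E N → ℝ} {g : Fin N → E N → ℝ}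
    (hf : MemLp f 2) (hg : ∀ i, MemLp (g i) 2) (h : ∀ i, HasWeakPartial i f (g i))
    {ε : ℝ≥0∞} (hε : 0 < ε) :
    ∃ ψ : E N → ℝ, ContDiff ℝ ∞ ψ ∧ HasCompactSupport ψ ∧
      eLpNorm (fun x => ψ x - f x) 2 ≤ ε ∧
      ∀ i, eLpNorm (fun x => partialDeriv i ψ x - g i x) 2 ≤ ε := by
  have hε3 : 0 < ε / 3 := ENNReal.div_pos hε.ne' (by simp)
  have e1 := (ENNReal.tendsto_nhds_zero.1 (tendsto_cutoff_mul hf)) _ hε3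
  have e2 : ∀ᶠ n : ℕ in atTop, ∀ i,
      eLpNorm (fun x => cutoff N (n + 1 : ℝ) x * g i x - g i x) 2 ≤ ε / 3 :=
    eventually_all.2 fun i => (ENNReal.tendsto_nhds_zero.1 (tendsto_cutoff_mul (hg i))) _ hε3
  have e3 : ∀ᶠ n : ℕ in atTop, ∀ i,
      eLpNorm (fun x => partialDeriv i (cutoff N (n + 1 : ℝ)) x * f x) 2 ≤ ε / 3 :=
    eventually_all.2 fun i =>
      (ENNReal.tendsto_nhds_zero.1 (tendsto_partialDeriv_cutoff_mul i hf)) _ hε3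
  obtain ⟨n, hn1, hn2, hn3⟩ := (e1.and (e2.and e3)).exists
  have hρ : (0 : ℝ) < n + 1 := by positivity
  set χ := cutoff N (n + 1 : ℝ) with hχ
  have hχs : ContDiff ℝ ∞ χ := contDiff_cutoff N _
  have hχc : HasCompactSupport χ := hasCompactSupport_cutoff N hρ
  have hχd : ∀ i, ContDiff ℝ ∞ (partialDeriv i χ) := fun i => contDiff_partialDeriv i hχs
  have hχdc : ∀ i, HasCompactSupport (partialDeriv i χ) := fun i => hχc.fderiv_apply ℝ _
  have hmem : ∀ {η u : E N → ℝ}, Continuous η → HasCompactSupport η → MemLp u 2 →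
      MemLp (fun x => η x * u x) 2 := by
    intro η u hη hc hu
    obtain ⟨C, hC⟩ := hc.exists_bound_of_continuous hη
    exact MemLp.of_le_mul (c := C) hu (hη.aestronglyMeasurable.mul hu.1)
      (Eventually.of_forall fun x => by
        rw [norm_mul]; exact mul_le_mul_of_nonneg_right (hC x) (norm_nonneg _))
  have m1 : MemLp (fun x => χ x * f x) 2 := hmem hχs.continuous hχc hf
  have m2 : ∀ i, MemLp (fun x => χ x * g i x) 2 := fun i => hmem hχs.continuous hχc (hg i)
  have m3 : ∀ i, MemLp (fun x => partialDeriv i χ x * f x) 2 := fun i =>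
    hmem (hχd i).continuous (hχdc i) hf
  obtain ⟨ψ, hψ, hψc, hψ1, hψ2⟩ := exists_test_approx_of_hasCompactSupport m1
    (fun i => (m2 i).add (m3 i)) (fun i => (h i).smooth_mul hf (hg i) hχs)
    hχc.mul_right (fun i => (hχc.mul_right).add (hχdc i).mul_right) hε3
  have hψm : MemLp ψ 2 := hψ.continuous.memLp_of_hasCompactSupport hψc
  have hψd : ∀ i, MemLp (partialDeriv i ψ) 2 := fun i =>
    (contDiff_partialDeriv i hψ).continuous.memLp_of_hasCompactSupport (hψc.fderiv_apply ℝ _)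
  refine ⟨ψ, hψ, hψc, ?_, fun i => ?_⟩
  · have e : (fun x => ψ x - f x) = (fun x => ψ x - χ x * f x) + fun x => χ x * f x - f x := by
      ext x; simp
    rw [e]
    refine (eLpNorm_add_le (hψm.sub m1).1 (m1.sub hf).1 one_le_two).trans ?_
    calc _ ≤ ε / 3 + ε / 3 := add_le_add hψ1 hn1
      _ ≤ ε / 3 + ε / 3 + ε / 3 := le_self_add
      _ = ε := ENNReal.add_thirds ε
  · have e : (fun x => partialDeriv i ψ x - g i x) =
        (fun x => partialDeriv i ψ x - (χ x * g i x + partialDeriv i χ x * f x)) +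
        ((fun x => χ x * g i x - g i x) + fun x => partialDeriv i χ x * f x) := by
      ext x; simp only [Pi.add_apply]; ring
    rw [e]
    refine (eLpNorm_add_le ((hψd i).sub ((m2 i).add (m3 i))).1
      (((m2 i).sub (hg i)).add (m3 i)).1 one_le_two).trans ?_
    calc _ ≤ ε / 3 + (ε / 3 + ε / 3) := by
          refine add_le_add (hψ2 i) ((eLpNorm_add_le ((m2 i).sub (hg i)).1 (m3 i).1
            one_le_two).trans (add_le_add (hn2 i) (hn3 i)))
      _ = ε := by rw [← add_assoc, ENNReal.add_thirds ε]

/-- The test functions approximating an element of `H¹`, as a sequence. -/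
lemma exists_test_seq {N : ℕ} {f : E N → ℝ} {g : Fin N → E N → ℝ}
    (hf : MemLp f 2) (hg : ∀ i, MemLp (g i) 2) (h : ∀ i, HasWeakPartial i f (g i)) :
    ∃ ψ : ℕ → E N → ℝ, (∀ n, ContDiff ℝ ∞ (ψ n)) ∧ (∀ n, HasCompactSupport (ψ n)) ∧
      Tendsto (fun n => eLpNorm (fun x => ψ n x - f x) 2) atTop (𝓝 0) ∧
      ∀ i, Tendsto (fun n => eLpNorm (fun x => partialDeriv i (ψ n) x - g i x) 2)
        atTop (𝓝 0) := by
  have hpos : ∀ n : ℕ, (0 : ℝ≥0∞) < (n : ℝ≥0∞)⁻¹ := fun n =>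
    ENNReal.inv_pos.2 (ENNReal.natCast_ne_top n)
  choose ψ h1 h2 h3 h4 using fun n : ℕ => exists_test_approx hf hg h (hpos n)
  exact ⟨ψ, h1, h2, tendsto_of_tendsto_of_tendsto_of_le_of_le tendsto_const_nhds
    ENNReal.tendsto_inv_nat_nhds_zero (fun _ => zero_le) h3,
    fun i => tendsto_of_tendsto_of_tendsto_of_le_of_le tendsto_const_nhds
    ENNReal.tendsto_inv_nat_nhds_zero (fun _ => zero_le) fun n => h4 n i⟩

/-! ### Integration by parts and the Sobolev inequality -/

lemma tendsto_integral_mul_of_tendsto_eLpNorm {N : ℕ} {h f : E N → ℝ} {ψ : ℕ → E N → ℝ}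
    (hh : MemLp h 2) (hf : MemLp f 2) (hψ : ∀ n, MemLp (ψ n) 2)
    (hlim : Tendsto (fun n => eLpNorm (fun x => ψ n x - f x) 2) atTop (𝓝 0)) :
    Tendsto (fun n => ∫ x, h x * ψ n x) atTop (𝓝 (∫ x, h x * f x)) := by
  have key : ∀ {u : E N → ℝ} (hu : MemLp u 2),
      ∫ x, h x * u x = inner ℝ (hh.toLp h) (hu.toLp u) := by
    intro u hu
    rw [L2.inner_def]
    refine integral_congr_ae ?_
    filter_upwards [hh.coeFn_toLp, hu.coeFn_toLp] with x h1 h2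
    simp [h1, h2, mul_comm]
  have h2 : Tendsto (fun n => (hψ n).toLp (ψ n)) atTop (𝓝 (hf.toLp f)) := by
    rw [tendsto_iff_edist_tendsto_0]
    refine hlim.congr fun n => ?_
    rw [Lp.edist_toLp_toLp]
    rfl
  rw [key hf]
  simp only [fun n => key (hψ n)]
  exact tendsto_const_nhds.inner h2

/-- Integration by parts against an element of `H¹`. -/
lemma HasWeakPartial.integral_mul {N : ℕ} {j : Fin N} {h w f : E N → ℝ} {g : Fin N → E N → ℝ}
    (hw : HasWeakPartial j h w) (hh : MemLp h 2) (hwm : MemLp w 2)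
    (hf : MemLp f 2) (hg : ∀ i, MemLp (g i) 2) (hfg : ∀ i, HasWeakPartial i f (g i)) :
    ∫ x, h x * g j x = - ∫ x, w x * f x := by
  obtain ⟨ψ, h1, h2, h3, h4⟩ := exists_test_seq hf hg hfg
  have t1 := tendsto_integral_mul_of_tendsto_eLpNorm hwm hf
    (fun n => (h1 n).continuous.memLp_of_hasCompactSupport (h2 n)) h3
  have t2 := tendsto_integral_mul_of_tendsto_eLpNorm hh (hg j)
    (fun n => (contDiff_partialDeriv j (h1 n)).continuous.memLp_of_hasCompactSupport
      ((h2 n).fderiv_apply ℝ _)) (h4 j)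
  refine tendsto_nhds_unique t2 (t1.neg.congr fun n => ?_)
  exact (hw (ψ n) (h1 n) (h2 n)).symm

lemma norm_fderiv_le_sum {N : ℕ} (ψ : E N → ℝ) (x : E N) :
    ‖fderiv ℝ ψ x‖ ≤ ∑ i, |partialDeriv i ψ x| := by
  refine ContinuousLinearMap.opNorm_le_bound _ (Finset.sum_nonneg fun _ _ => abs_nonneg _)
    fun v => ?_
  have hv : v = ∑ i, v i • EuclideanSpace.single i (1 : ℝ) := by
    ext j
    simp [Finset.sum_apply, Pi.single_apply]
  conv_lhs => rw [hv, map_sum]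
  refine (norm_sum_le _ _).trans ?_
  rw [Finset.sum_mul]
  refine Finset.sum_le_sum fun i _ => ?_
  rw [map_smul, norm_smul, mul_comm]
  exact mul_le_mul_of_nonneg_left (PiLp.norm_apply_le v i) (abs_nonneg _)

/-- The Sobolev exponent `2^* = 2N/(N-2)`. -/
noncomputable def sobolevExp (N : ℕ) : ℝ := 2 * (N : ℝ) / (N - 2)

lemma sobolevExp_eq {N : ℕ} (hN : 3 ≤ N) :
    (sobolevExp N)⁻¹ = (2 : ℝ)⁻¹ - (N : ℝ)⁻¹ ∧ 2 < sobolevExp N := by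
  have h3 : (3 : ℝ) ≤ N := by exact_mod_cast hN
  have h2 : (0 : ℝ) < N - 2 := by linarith
  unfold sobolevExp
  constructor
  · field_simp
  · rw [lt_div_iff₀ h2]; linarith

/-- The Sobolev inequality `‖f‖_{2^*} ≤ S ∑ᵢ ‖∂ᵢ f‖₂` in `H¹`: the Gagliardo–Nirenberg–Sobolev
inequality for test functions passes to the limit by Fatou's lemma. -/
lemma exists_sobolev {N : ℕ} (hN : 3 ≤ N) : ∃ S : NNReal, ∀ (f : E N → ℝ) (g : Fin N → E N → ℝ),
    MemLp f 2 → (∀ i, MemLp (g i) 2) → (∀ i, HasWeakPartial i f (g i)) →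
    eLpNorm f (ENNReal.ofReal (sobolevExp N)) ≤ S * ∑ i, eLpNorm (g i) 2 := by
  obtain ⟨hs1, hs2⟩ := sobolevExp_eq hN
  refine ⟨SNormLESNormFDerivOfEqConst ℝ (volume : Measure (E N)) ((2 : NNReal) : ℝ),
    fun f g hf hg h => ?_⟩
  set S := SNormLESNormFDerivOfEqConst ℝ (volume : Measure (E N)) ((2 : NNReal) : ℝ)
  have test : ∀ ψ : E N → ℝ, ContDiff ℝ ∞ ψ → HasCompactSupport ψ →
      eLpNorm ψ (ENNReal.ofReal (sobolevExp N)) ≤ S * ∑ i, eLpNorm (partialDeriv i ψ) 2 := by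
    intro ψ hψ hc
    have h1 := eLpNorm_le_eLpNorm_fderiv_of_eq (volume : Measure (E N))
      (p := 2) (p' := (sobolevExp N).toNNReal) (hψ.of_le (by simp)) hc one_le_two
      (by rw [finrank_euclideanSpace_fin]; omega)
      (by rw [finrank_euclideanSpace_fin, Real.coe_toNNReal _ (by linarith), hs1]; simp)
    refine h1.trans ?_
    gcongr
    have h2 : eLpNorm (fderiv ℝ ψ) 2 volume ≤
        eLpNorm (∑ i, fun x => |partialDeriv i ψ x|) 2 volume := by
      refine eLpNorm_mono_real fun x => ?_
      rw [Finset.sum_apply]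
      exact norm_fderiv_le_sum ψ x
    refine (h2.trans (eLpNorm_sum_le (fun i _ => ?_) one_le_two)).trans
      (Finset.sum_le_sum fun i _ => ?_)
    · exact (contDiff_partialDeriv i hψ).continuous.abs.aestronglyMeasurable
    · exact (eLpNorm_norm (partialDeriv i ψ)).le
  obtain ⟨ψ, h1, h2, h3, h4⟩ := exists_test_seq hf hg h
  have hm := tendstoInMeasure_of_tendsto_eLpNorm (by simp)
    (fun n => (h1 n).continuous.aestronglyMeasurable) hf.1 h3
  obtain ⟨ns, hns, hae⟩ := hm.exists_seq_tendsto_ae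
  refine (Lp.eLpNorm_lim_le_liminf_eLpNorm
    (fun n => (h1 (ns n)).continuous.aestronglyMeasurable) f hae).trans ?_
  have hb : ∀ n, eLpNorm (ψ (ns n)) (ENNReal.ofReal (sobolevExp N)) ≤
      S * ∑ i, (eLpNorm (fun x => partialDeriv i (ψ (ns n)) x - g i x) 2 + eLpNorm (g i) 2) := by
    intro n
    refine (test _ (h1 _) (h2 _)).trans ?_
    gcongr with i
    have hd : AEStronglyMeasurable (partialDeriv i (ψ (ns n))) :=
      (contDiff_partialDeriv i (h1 (ns n))).continuous.aestronglyMeasurable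
    have := eLpNorm_add_le (p := 2) (hd.sub (hg i).1) (hg i).1 one_le_two
    rwa [sub_add_cancel] at this
  have hlim : Tendsto (fun n => S * ∑ i,
      (eLpNorm (fun x => partialDeriv i (ψ (ns n)) x - g i x) 2 + eLpNorm (g i) 2)) atTop
      (𝓝 (S * ∑ i, (0 + eLpNorm (g i) 2))) :=
    ENNReal.Tendsto.const_mul (tendsto_finsetSum _ fun i _ =>
      ((h4 i).comp hns.tendsto_atTop).add tendsto_const_nhds) (Or.inr ENNReal.coe_ne_top)
  simp only [zero_add] at hlim
  rw [← hlim.liminf_eq]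
  exact liminf_le_liminf (Eventually.of_forall hb)

lemma norm_toL2_le {N : ℕ} (u : H1 N) : ‖toL2 u‖ ≤ ‖u‖ := WithLp.norm_fst_le (x := u.1)

lemma norm_grad_le {N : ℕ} (u : H1 N) (i : Fin N) : ‖grad u i‖ ≤ ‖u‖ :=
  (PiLp.norm_apply_le _ i).trans (WithLp.norm_snd_le (x := u.1))

lemma hasWeakPartial_toL2 {N : ℕ} (u : H1 N) (i : Fin N) :
    HasWeakPartial i (toL2 u) (grad u i) := u.2 i

lemma integral_sq_eq_norm_sq {N : ℕ} (f : L2 N) : ∫ x, f x ^ 2 = ‖f‖ ^ 2 := by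
  rw [← real_inner_self_eq_norm_sq, L2.inner_def]
  congr 1 with x
  simp [sq]

lemma integrable_sq_L2 {N : ℕ} (f : L2 N) : Integrable (fun x => f x ^ 2) :=
  (Lp.memLp f).integrable_sq

/-- On a ball of `H¹` the integrals `∫ |u|^r`, `2 ≤ r ≤ 2^*`, are bounded. -/
lemma exists_integral_rpow_le {N : ℕ} (hN : 3 ≤ N) {R : ℝ} (hR : 0 ≤ R) :
    ∃ K : ℝ, 0 < K ∧
    ∀ u : H1 N, ‖u‖ ≤ R → ∀ r : ℝ, 2 ≤ r → r ≤ sobolevExp N →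
      Integrable (fun x => |toL2 u x| ^ r) ∧ ∫ x, |toL2 u x| ^ r ≤ K := by
  obtain ⟨S, hS⟩ := exists_sobolev hN
  obtain ⟨-, hs2⟩ := sobolevExp_eq hN
  have hs0 : 0 < sobolevExp N := by linarith
  refine ⟨1 + (R ^ 2 + (S * ∑ _i : Fin N, R) ^ sobolevExp N), by positivity,
    fun u hu r hr2 hr => ?_⟩
  have hb := hS (toL2 u) (fun i => grad u i) (Lp.memLp _) (fun i => Lp.memLp _)
    (hasWeakPartial_toL2 u)
  have hb2 : eLpNorm (toL2 u) (ENNReal.ofReal (sobolevExp N)) volume ≤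
      ENNReal.ofReal (S * ∑ _i : Fin N, R) := by
    refine hb.trans ?_
    rw [ENNReal.ofReal_mul S.coe_nonneg, ENNReal.ofReal_coe_nnreal,
      ENNReal.ofReal_sum_of_nonneg (fun _ _ => hR)]
    gcongr with i
    rw [← Lp.enorm_def, ← ofReal_norm]
    exact ENNReal.ofReal_le_ofReal ((norm_grad_le u i).trans hu)
  have hmem : MemLp (toL2 u) (ENNReal.ofReal (sobolevExp N)) :=
    ⟨(Lp.memLp _).1, hb2.trans_lt ENNReal.ofReal_lt_top⟩
  have hp0 : ENNReal.ofReal (sobolevExp N) ≠ 0 := by simpa using hs0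
  have i2 : Integrable (fun x => |toL2 u x| ^ sobolevExp N) := by
    have := hmem.integrable_norm_rpow hp0 ENNReal.ofReal_ne_top
    rwa [ENNReal.toReal_ofReal hs0.le] at this
  have b2 : ∫ x, |toL2 u x| ^ sobolevExp N ≤ (S * ∑ _i : Fin N, R) ^ sobolevExp N := by
    have := hmem.eLpNorm_eq_integral_rpow_norm hp0 ENNReal.ofReal_ne_top
    rw [this, ENNReal.toReal_ofReal hs0.le,
      ENNReal.ofReal_le_ofReal_iff (by positivity)] at hb2
    rwa [Real.rpow_inv_le_iff_of_pos (integral_nonneg fun x => by positivity)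
      (by positivity) hs0] at hb2
  have b1 : ∫ x, toL2 u x ^ 2 ≤ R ^ 2 := by
    rw [integral_sq_eq_norm_sq]
    gcongr
    exact (norm_toL2_le u).trans hu
  have hpt : ∀ x, |toL2 u x| ^ r ≤ toL2 u x ^ 2 + |toL2 u x| ^ sobolevExp N := by
    intro x
    rcases le_or_gt |toL2 u x| 1 with h | h
    · have h1 : |toL2 u x| ^ r ≤ |toL2 u x| ^ (2 : ℝ) :=
        Real.rpow_le_rpow_of_exponent_ge' (abs_nonneg _) h (by norm_num) hr2
      rw [Real.rpow_two, sq_abs] at h1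
      have : 0 ≤ |toL2 u x| ^ sobolevExp N := by positivity
      linarith
    · have h1 : |toL2 u x| ^ r ≤ |toL2 u x| ^ sobolevExp N :=
        Real.rpow_le_rpow_of_exponent_le h.le hr
      nlinarith [sq_nonneg (toL2 u x)]
  have i3 := (integrable_sq_L2 (toL2 u)).add i2
  have hm : AEStronglyMeasurable (fun x => |toL2 u x| ^ r) volume :=
    ((Lp.memLp (toL2 u)).1.norm.aemeasurable.pow_const r).aestronglyMeasurable
  have hi : Integrable (fun x => |toL2 u x| ^ r) := by
    refine i3.mono' hm (Eventually.of_forall fun x => ?_)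
    rw [Real.norm_of_nonneg (by positivity)]
    exact hpt x
  refine ⟨hi, ?_⟩
  have := integral_mono hi i3 hpt
  simp only [Pi.add_apply] at this
  rw [integral_add (integrable_sq_L2 (toL2 u)) i2] at this
  linarith

/-! ### Uniform tails of almost-periodic functions -/

/-- Almost-periodic functions with values in `L^p` have totally bounded range. -/
lemma APLp.exists_finite_net {N : ℕ} {p : ℝ} (hp : 1 ≤ p) {b : ℝ → E N → ℝ} (hb : APLp p b)
    {ε : ℝ≥0∞} (hε : 0 < ε) :
    ∃ t : Finset ℝ, ∀ τ, ∃ σ ∈ t, distLp p (b τ) (b σ) ≤ ε := by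
  obtain ⟨hmem, hcont, hper⟩ := hb
  have hε2 : 0 < ε / 2 := ENNReal.half_pos hε.ne'
  obtain ⟨L, -, hL⟩ := hper (ε / 2) hε2
  obtain ⟨t, -, ht⟩ := (isCompact_Icc (a := (0 : ℝ)) (b := L)).elim_nhds_subcover
    (fun σ => {τ | distLp p (b τ) (b σ) ≤ ε / 2})
    (fun σ _ => ENNReal.tendsto_nhds_zero.1 (hcont σ) _ hε2)
  refine ⟨t, fun τ => ?_⟩
  -- an almost-period moves `τ` into `[0, L]`
  obtain ⟨h, hh, hd⟩ := hL (-τ)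
  have hmemI : τ + h ∈ Icc 0 L := ⟨by linarith [hh.1], by linarith [hh.2]⟩
  obtain ⟨σ, hσ, hτσ⟩ := mem_iUnion₂.1 (ht hmemI)
  refine ⟨σ, hσ, ?_⟩
  have e : (fun x => b τ x - b σ x) =
      (fun x => b τ x - b (τ + h) x) + fun x => b (τ + h) x - b σ x := by
    ext x; simp
  have h1 : distLp p (b τ) (b (τ + h)) ≤ ε / 2 := by
    have := hd τ
    unfold distLp at this ⊢
    rwa [show (fun x => b τ x - b (τ + h) x) = b τ - b (τ + h) from rfl, eLpNorm_sub_comm]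
  unfold distLp
  rw [e]
  refine (eLpNorm_add_le ((hmem _).sub (hmem _)).1 ((hmem _).sub (hmem _)).1
    (by simpa using ENNReal.ofReal_le_ofReal hp)).trans ?_
  exact (add_le_add h1 hτσ).trans (ENNReal.add_halves ε).le

lemma APLp.exists_tail_le {N : ℕ} {p : ℝ} (hp : 1 ≤ p) {b : ℝ → E N → ℝ} (hb : APLp p b)
    {ε : ℝ≥0∞} (hε : 0 < ε) :
    ∃ t : Finset ℝ, ∀ τ (k : ℕ),
      eLpNorm (b τ) (ENNReal.ofReal p) (volume.restrict (outer N k)) ≤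
      ε + ∑ σ ∈ t, eLpNorm (b σ) (ENNReal.ofReal p) (volume.restrict (outer N k)) := by
  obtain ⟨t, ht⟩ := hb.exists_finite_net hp hε
  refine ⟨t, fun τ k => ?_⟩
  obtain ⟨σ, hσ, hd⟩ := ht τ
  set μ := (volume : Measure (E N)).restrict (outer N k)
  have hm : ∀ τ, MemLp (b τ) (ENNReal.ofReal p) μ := fun τ => (hb.1 τ).restrict _
  have h1 := eLpNorm_add_le (p := ENNReal.ofReal p) ((hm τ).sub (hm σ)).1 (hm σ).1
    (by simpa using ENNReal.ofReal_le_ofReal hp)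
  rw [sub_add_cancel] at h1
  refine h1.trans (add_le_add ((eLpNorm_mono_measure _ Measure.restrict_le_self).trans hd) ?_)
  exact Finset.single_le_sum
    (f := fun σ => eLpNorm (b σ) (ENNReal.ofReal p) μ) (fun _ _ => zero_le) hσ

/-- The tails of an almost-periodic function with values in `L^p` tend to zero uniformly in
time. -/
lemma APLp.exists_decayRate {N : ℕ} {p : ℝ} (hp : 1 ≤ p) {b : ℝ → E N → ℝ} (hb : APLp p b) :
    ∃ m : ℕ → ℝ, (∀ k, 0 ≤ m k) ∧ Tendsto m atTop (𝓝 0) ∧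
      ∀ τ (k : ℕ), ∫ x in outer N k, |b τ x| ^ p ≤ m k := by
  have hp0 : 0 < p := by linarith
  have hP0 : ENNReal.ofReal p ≠ 0 := by simpa using hp0
  set B : ℕ → ℝ≥0∞ := fun k =>
    ⨆ τ, eLpNorm (b τ) (ENNReal.ofReal p) (volume.restrict (outer N k)) with hB
  have hfin : ∀ k, B k ≠ ⊤ := by
    intro k
    obtain ⟨t, ht⟩ := hb.exists_tail_le hp one_pos
    refine ((iSup_le fun τ => ht τ k).trans_lt ?_).ne
    exact ENNReal.add_lt_top.2 ⟨ENNReal.one_lt_top,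
      ENNReal.sum_lt_top.2 fun σ _ => ((hb.1 σ).restrict _).2⟩
  have hlim : Tendsto B atTop (𝓝 0) := by
    rw [ENNReal.tendsto_nhds_zero]
    intro ε hε
    have hε2 : 0 < ε / 2 := ENNReal.half_pos hε.ne'
    obtain ⟨t, ht⟩ := hb.exists_tail_le hp hε2
    have hs : Tendsto (fun k : ℕ => ∑ σ ∈ t,
        eLpNorm (b σ) (ENNReal.ofReal p) (volume.restrict (outer N k))) atTop (𝓝 0) := by
      have := tendsto_finsetSum t fun σ _ => tendsto_eLpNorm_outer hP0 (by simp) (hb.1 σ)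
      simpa using this
    filter_upwards [ENNReal.tendsto_nhds_zero.1 hs _ hε2] with k hk
    exact iSup_le fun τ => ((ht τ k).trans (add_le_add le_rfl hk)).trans (ENNReal.add_halves ε).le
  refine ⟨fun k => (B k).toReal ^ p, fun k => by positivity, ?_, fun τ k => ?_⟩
  · have h1 := (ENNReal.tendsto_toReal (a := 0) (by simp)).comp hlim
    have h2 := h1.rpow_const (p := p) (Or.inr hp0.le)
    simpa [Real.zero_rpow hp0.ne'] using h2
  · have hle : eLpNorm (b τ) (ENNReal.ofReal p) (volume.restrict (outer N k)) ≤
        ENNReal.ofReal (B k).toReal := by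
      rw [ENNReal.ofReal_toReal (hfin k)]
      exact le_iSup (fun τ => eLpNorm (b τ) (ENNReal.ofReal p) (volume.restrict (outer N k))) τ
    rw [((hb.1 τ).restrict _).eLpNorm_eq_integral_rpow_norm hP0 ENNReal.ofReal_ne_top,
      ENNReal.toReal_ofReal hp0.le, ENNReal.ofReal_le_ofReal_iff (by positivity),
      Real.rpow_inv_le_iff_of_pos (integral_nonneg fun x => by positivity) (by positivity) hp0]
      at hle
    exact hle

lemma exists_tailRate {N : ℕ} {p : ℝ} (hp : 1 ≤ p) {b c : ℝ → E N → ℝ} (hb : APLp p b)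
    (hc : APLp 1 c) : ∃ m : ℕ → ℝ, TailRate p b c m := by
  obtain ⟨m₁, h1, h2, h3⟩ := hb.exists_decayRate hp
  obtain ⟨m₂, h4, h5, h6⟩ := hc.exists_decayRate le_rfl
  refine ⟨fun k => m₁ k + m₂ k + 1 / ((k : ℝ) + 1), fun k => ?_, ?_, fun τ k => ?_⟩
  · have := h1 k
    have := h4 k
    positivity
  · simpa using (h2.add h5).add (tendsto_one_div_add_atTop_nhds_zero_nat (𝕜 := ℝ))
  · have a1 := h3 τ k
    have a2 := h6 τ k
    simp only [Real.rpow_one, outer] at a1 a2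
    have : (0 : ℝ) ≤ 1 / ((k : ℝ) + 1) := by positivity
    linarith

/-! ### Ellipticity of the homotopy -/

/-- The closed convex set of nonnegative matrices with entries bounded by `B`. It contains the
coefficient matrices, hence those of the hull, their mean, and the matrices of the homotopy. -/
structure IsBddNonneg {N : ℕ} (B : ℝ) (A : M1 N) : Prop where
  nonneg : ∀ ξ : Fin N → ℝ, 0 ≤ ∑ i, ∑ j, A i j * ξ i * ξ j
  bdd : ∀ i j, |A i j| ≤ B

lemma CondH1.isBddNonneg {N : ℕ} {ν₀ : ℝ} (hν : 0 < ν₀) {a : ℝ → M1 N} (h : CondH1 ν₀ a) (τ : ℝ) :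
    IsBddNonneg ν₀⁻¹ (a τ) := by
  have hlow : ∀ ξ : Fin N → ℝ, 0 ≤ ∑ i, ∑ j, a τ i j * ξ i * ξ j := fun ξ =>
    le_trans (by positivity) (h.lower τ (WithLp.toLp 2 ξ))
  refine ⟨hlow, fun i j => ?_⟩
  have hup : ∀ ξ : Fin N → ℝ, ∑ i, ∑ j, a τ i j * ξ i * ξ j ≤ ν₀⁻¹ * ∑ i, ξ i ^ 2 := by
    intro ξ
    have := h.upper τ (WithLp.toLp 2 ξ)
    rwa [EuclideanSpace.real_norm_sq_eq] at this
  -- polarization: test the form with `eᵢ ± eⱼ`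
  have quad : ∀ s : ℝ, ∑ k, ∑ l, a τ k l * (Pi.single i 1 + s • Pi.single j 1 : Fin N → ℝ) k *
      (Pi.single i 1 + s • Pi.single j 1 : Fin N → ℝ) l =
      a τ i i + s * a τ i j + s * a τ j i + s ^ 2 * a τ j j := by
    intro s
    simp [mul_add, add_mul, Finset.sum_add_distrib, Pi.single_apply]
    ring
  have hsym := h.symm τ j i
  rcases eq_or_ne i j with rfl | hij
  · have q := quad 0
    have l := hlow (Pi.single i 1 + (0 : ℝ) • Pi.single i 1)
    have u := hup (Pi.single i 1 + (0 : ℝ) • Pi.single i 1)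
    rw [q] at l u
    simp [Pi.single_apply] at l u
    rw [abs_le]
    constructor <;> linarith [inv_pos.2 hν]
  · have nrm : ∀ s : ℝ, ∑ k, (Pi.single i 1 + s • Pi.single j 1 : Fin N → ℝ) k ^ 2 = 1 + s ^ 2 := by
      intro s
      simp [add_sq, Finset.sum_add_distrib, Pi.single_apply, hij.symm]
    have l1 := hlow (Pi.single i 1 + (1 : ℝ) • Pi.single j 1)
    have u1 := hup (Pi.single i 1 + (1 : ℝ) • Pi.single j 1)
    have l2 := hlow (Pi.single i 1 + (-1 : ℝ) • Pi.single j 1)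
    have u2 := hup (Pi.single i 1 + (-1 : ℝ) • Pi.single j 1)
    rw [quad] at l1 u1 l2 u2
    rw [nrm] at u1 u2
    rw [abs_le]
    constructor <;> linarith [inv_pos.2 hν]

lemma IsBddNonneg.convex {N : ℕ} {B lam : ℝ} {A A' : M1 N} (h : IsBddNonneg B A)
    (h' : IsBddNonneg B A') (hlam : lam ∈ Icc (0 : ℝ) 1) :
    IsBddNonneg B (fun i j => lam * A i j + (1 - lam) * A' i j) := by
  obtain ⟨h0, h1⟩ := hlam
  refine ⟨fun ξ => ?_, fun i j => ?_⟩
  · have e : ∑ i, ∑ j, (lam * A i j + (1 - lam) * A' i j) * ξ i * ξ j =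
        lam * (∑ i, ∑ j, A i j * ξ i * ξ j) + (1 - lam) * ∑ i, ∑ j, A' i j * ξ i * ξ j := by
      simp only [Finset.mul_sum, ← Finset.sum_add_distrib]
      refine Finset.sum_congr rfl fun i _ => Finset.sum_congr rfl fun j _ => ?_
      ring
    rw [e]
    exact add_nonneg (mul_nonneg h0 (h.nonneg ξ)) (mul_nonneg (by linarith) (h'.nonneg ξ))
  · have a1 := abs_le.1 (h.bdd i j)
    have a2 := abs_le.1 (h'.bdd i j)
    have h2 : 0 ≤ 1 - lam := by linarith
    rw [abs_le]
    constructor <;> nlinarith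

lemma isBddNonneg_of_tendsto {N : ℕ} {B : ℝ} {ι : Type*} {l : Filter ι} [l.NeBot] {A : ι → M1 N}
    {A₀ : M1 N} (hA : ∀ᶠ n in l, IsBddNonneg B (A n))
    (hlim : ∀ i j, Tendsto (fun n => A n i j) l (𝓝 (A₀ i j))) : IsBddNonneg B A₀ := by
  refine ⟨fun ξ => ?_, fun i j => ?_⟩
  · refine ge_of_tendsto (x := l) (f := fun n => ∑ i, ∑ j, A n i j * ξ i * ξ j)
      (tendsto_finsetSum _ fun i _ => tendsto_finsetSum _ fun j _ =>
        ((hlim i j).mul_const _).mul_const _) ?_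
    filter_upwards [hA] with n hn using hn.nonneg ξ
  · refine le_of_tendsto (hlim i j).abs ?_
    filter_upwards [hA] with n hn using hn.bdd i j

lemma CondH1.continuous {N : ℕ} {ν₀ : ℝ} {a : ℝ → M1 N} (h : CondH1 ν₀ a) (i j : Fin N) :
    Continuous (fun τ => a τ i j) := by
  obtain ⟨θ, C, h0, -, hC, hH⟩ := h.holder
  rw [continuous_iff_continuousAt]
  intro τ₀
  have h1 : Tendsto (fun τ => C * |τ - τ₀| ^ θ) (𝓝 τ₀) (𝓝 0) := by
    have : Continuous (fun τ => C * |τ - τ₀| ^ θ) :=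
      continuous_const.mul ((continuous_id.sub continuous_const).abs.rpow_const
        fun _ => Or.inr h0.le)
    have h2 := this.tendsto τ₀
    simpa [Real.zero_rpow h0.ne'] using h2
  rw [ContinuousAt, tendsto_iff_dist_tendsto_zero]
  exact squeeze_zero (fun _ => dist_nonneg) (fun τ => hH τ τ₀ i j) h1

lemma IsMeanM1.isBddNonneg {N : ℕ} {ν₀ : ℝ} (hν : 0 < ν₀) {a : ℝ → M1 N} (h : CondH1 ν₀ a)
    {abar : M1 N} (hm : IsMeanM1 a abar) : IsBddNonneg ν₀⁻¹ abar := by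
  refine isBddNonneg_of_tendsto (l := atTop)
    (A := fun T i j => (2 * T)⁻¹ * ∫ τ in (-T)..T, a τ i j) ?_ hm
  filter_upwards [eventually_gt_atTop 0] with T hT
  have hint : ∀ i j, IntervalIntegrable (fun τ => a τ i j) volume (-T) T := fun i j =>
    (h.continuous i j).intervalIntegrable _ _
  refine ⟨fun ξ => ?_, fun i j => ?_⟩
  · have e : ∑ i, ∑ j, ((2 * T)⁻¹ * ∫ τ in (-T)..T, a τ i j) * ξ i * ξ j =
        (2 * T)⁻¹ * ∫ τ in (-T)..T, ∑ i, ∑ j, a τ i j * ξ i * ξ j := by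
      rw [intervalIntegral.integral_finsetSum]
      · rw [Finset.mul_sum]
        refine Finset.sum_congr rfl fun i _ => ?_
        rw [intervalIntegral.integral_finsetSum]
        · rw [Finset.mul_sum]
          refine Finset.sum_congr rfl fun j _ => ?_
          rw [intervalIntegral.integral_mul_const, intervalIntegral.integral_mul_const]
          ring
        · exact fun j _ => ((hint i j).mul_const _).mul_const _
      · exact fun i _ => (continuous_finsetSum _ fun j _ =>
          ((h.continuous i j).mul_const _).mul_const _).intervalIntegrable _ _
    rw [e]
    refine mul_nonneg (by positivity) (intervalIntegral.integral_nonneg (by linarith) fun τ _ => ?_)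
    exact (h.isBddNonneg hν τ).nonneg ξ
  · have := intervalIntegral.norm_integral_le_of_norm_le_const (a := -T) (b := T)
      (f := fun τ => a τ i j) (C := ν₀⁻¹) fun τ _ => (h.isBddNonneg hν τ).bdd i j
    rw [Real.norm_eq_abs, sub_neg_eq_add, abs_of_pos (by linarith : 0 < T + T)] at this
    rw [abs_mul, abs_of_pos (by positivity : 0 < (2 * T)⁻¹), inv_mul_le_iff₀ (by positivity)]
    linarith

lemma InHull.isBddNonneg {N : ℕ} {ν₀ : ℝ} (hν : 0 < ν₀) {a : ℝ → M1 N} (h : CondH1 ν₀ a)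
    {F : ℝ → E N → ℝ → ℝ} {α : ℝ → M1 N} {Φ : ℝ → E N → ℝ → ℝ} (hh : InHull a F α Φ) (τ : ℝ) :
    IsBddNonneg ν₀⁻¹ (α τ) := by
  choose t ht using fun n : ℕ => hh.2 (n : ℝ≥0∞)⁻¹ (ENNReal.inv_pos.2 (ENNReal.natCast_ne_top n))
  have hlim : Tendsto (fun n => a (τ + t n)) atTop (𝓝 (α τ)) := by
    rw [tendsto_iff_edist_tendsto_0]
    refine tendsto_of_tendsto_of_tendsto_of_le_of_le tendsto_const_nhds
      ENNReal.tendsto_inv_nat_nhds_zero (fun _ => zero_le) fun n => ?_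
    rw [edist_comm]
    exact (ht n τ).1
  refine isBddNonneg_of_tendsto (l := atTop) (A := fun n => a (τ + t n))
    (Eventually.of_forall fun n => h.isBddNonneg hν _) fun i j => ?_
  exact tendsto_pi_nhds.1 (tendsto_pi_nhds.1 hlim i) j

/-! ### Nonlinearities evaluated along an `H¹` function -/

/-- `U` is measurable and `∫ |U|^r ≤ K` for all `2 ≤ r ≤ 2^*`. By the Sobolev inequality these
functions include the ball of radius `R` of `H¹`, with `K` depending on `R` only. -/
structure SobolevBdd {N : ℕ} (K : ℝ) (U : E N → ℝ) : Prop where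
  meas : Measurable U
  integrable : ∀ r : ℝ, 2 ≤ r → r ≤ sobolevExp N → Integrable (fun x => |U x| ^ r)
  bdd : ∀ r : ℝ, 2 ≤ r → r ≤ sobolevExp N → ∫ x, |U x| ^ r ≤ K

lemma exists_sobolevBdd {N : ℕ} (hN : 3 ≤ N) {R : ℝ} (hR : 0 ≤ R) :
    ∃ K : ℝ, 0 < K ∧ ∀ u : H1 N, ‖u‖ ≤ R → SobolevBdd K (toL2 u) := by
  obtain ⟨K, hK, h⟩ := exists_integral_rpow_le hN hR
  exact ⟨K, hK, fun u hu => ⟨(Lp.stronglyMeasurable _).measurable,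
    fun r h2 hr => (h u hu r h2 hr).1, fun r h2 hr => (h u hu r h2 hr).2⟩⟩

lemma betaExp_facts {N : ℕ} (hN : 3 ≤ N) : 0 < betaExp N ∧ betaExp N + 2 ≤ sobolevExp N := by
  have hs := (sobolevExp_eq hN).2
  have e : betaExp N = sobolevExp N / 2 - 1 := rfl
  rw [e]
  constructor <;> linarith

namespace SobolevBdd

variable {N : ℕ} {K : ℝ} {U : E N → ℝ}

lemma integrable_sq (h : SobolevBdd K U) (hN : 3 ≤ N) : Integrable (fun x => U x ^ 2) := by
  simpa using h.integrable 2 le_rfl (sobolevExp_eq hN).2.le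

lemma integral_sq_le (h : SobolevBdd K U) (hN : 3 ≤ N) : ∫ x, U x ^ 2 ≤ K := by
  simpa using h.bdd 2 le_rfl (sobolevExp_eq hN).2.le

lemma memLp (h : SobolevBdd K U) (hN : 3 ≤ N) : MemLp U 2 :=
  (memLp_two_iff_integrable_sq h.meas.aestronglyMeasurable).2 (h.integrable_sq hN)

lemma integrable_rpow_beta (h : SobolevBdd K U) (hN : 3 ≤ N) :
    Integrable (fun x => |U x| ^ (betaExp N + 2)) :=
  h.integrable _ (by linarith [(betaExp_facts hN).1]) (betaExp_facts hN).2

lemma integral_rpow_beta_le (h : SobolevBdd K U) (hN : 3 ≤ N) :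
    ∫ x, |U x| ^ (betaExp N + 2) ≤ K :=
  h.bdd _ (by linarith [(betaExp_facts hN).1]) (betaExp_facts hN).2

end SobolevBdd

/-- Integrated form of the growth condition on `f'`. -/
lemma abs_sub_le_of_abs_deriv_le {f : ℝ → ℝ} {C β : ℝ} (hC : 0 ≤ C) (hβ : 0 < β)
    (hf : Differentiable ℝ f) (hd : ∀ v, |deriv f v| ≤ C * (1 + |v| ^ β)) (v : ℝ) :
    |f v - f 0| ≤ C * (|v| + |v| ^ (β + 1)) := by
  have h := (convex_closedBall (0 : ℝ) |v|).norm_image_sub_le_of_norm_deriv_le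
    (f := f) (C := C * (1 + |v| ^ β)) (x := 0) (y := v) (fun w _ => hf w)
    (fun w hw => (hd w).trans ?_) (by simp) (by simp)
  · rw [sub_zero, Real.norm_eq_abs, Real.norm_eq_abs] at h
    refine h.trans (le_of_eq ?_)
    rw [Real.rpow_add_one' (abs_nonneg v) (by positivity)]
    ring
  · have hw' : |w| ≤ |v| := by simpa using hw
    gcongr

/-- The pointwise bound on `|U f(x,U)|` given by bounds on `f(x,0)` and on `f'`. -/
lemma abs_mul_le_of_abs_sub_le {c f g C β : ℝ} (hβ : 0 < β)
    (h : |f - g| ≤ C * (|c| + |c| ^ (β + 1))) :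
    |c * f| ≤ |c| * |g| + C * (c ^ 2 + |c| ^ (β + 2)) := by
  have h1 : |f| ≤ |g| + C * (|c| + |c| ^ (β + 1)) := by
    have := abs_sub_abs_le_abs_sub f g
    linarith
  have e : |c| ^ (β + 2) = |c| * |c| ^ (β + 1) := by
    rw [show β + 2 = (β + 1) + 1 by ring, Real.rpow_add_one' (abs_nonneg c) (by positivity),
      mul_comm]
  rw [abs_mul, e, ← sq_abs c]
  calc |c| * |f| ≤ |c| * (|g| + C * (|c| + |c| ^ (β + 1))) := by gcongr
    _ = _ := by ring

/-- A perturbation which is small in `M₂` contributes little to `∫ |U f(x,U)|`. The bound is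
expressed by an integrable majorant, because `f(x,U(x))` need not be known to be measurable. -/
lemma exists_majorant_of_m2Norm_le {N : ℕ} (hN : 3 ≤ N) {K : ℝ} {U : E N → ℝ}
    (hU : SobolevBdd K U) {f : E N → ℝ → ℝ} (hd : ∀ x, Differentiable ℝ (f x))
    (hm : MemLp (fun x => f x 0) 2) {ε : ℝ} (hε : 0 < ε) (hf : m2Norm f ≤ ENNReal.ofReal ε) :
    ∃ D : E N → ℝ, Integrable D ∧ (∀ x, |U x * f x (U x)| ≤ D x) ∧ ∫ x, D x ≤ ε * (3 * K + 1) := by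
  have hβ := (betaExp_facts hN).1
  have h0 : eLpNorm (fun x => f x 0) 2 volume ≤ ENNReal.ofReal ε := le_self_add.trans hf
  have h1 : ∀ x v, |deriv (f x) v| ≤ ε * (1 + |v| ^ betaExp N) := by
    intro x v
    have h2 : ENNReal.ofReal (|deriv (f x) v| / (1 + |v| ^ betaExp N)) ≤ ENNReal.ofReal ε :=
      (le_iSup₂ (f := fun x v => ENNReal.ofReal (|deriv (f x) v| / (1 + |v| ^ betaExp N)))
        x v).trans (le_add_self.trans hf)
    rwa [ENNReal.ofReal_le_ofReal_iff hε.le, div_le_iff₀ (by positivity)] at h2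
  have i0 : Integrable (fun x => f x 0 ^ 2) := hm.integrable_sq
  have b0 : ∫ x, f x 0 ^ 2 ≤ ε ^ 2 := by
    have h3 := hm.eLpNorm_eq_integral_rpow_norm (by simp) (by simp)
    rw [h3, ENNReal.ofReal_le_ofReal_iff hε.le] at h0
    simp only [ENNReal.toReal_ofNat, Real.norm_eq_abs, Real.rpow_two, sq_abs] at h0
    rwa [Real.rpow_inv_le_iff_of_pos (integral_nonneg fun x => sq_nonneg _) hε.le two_pos,
      Real.rpow_two] at h0
  have i1 := hU.integrable_sq hN
  have i2 := hU.integrable_rpow_beta hN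
  refine ⟨fun x => (ε * U x ^ 2 + ε⁻¹ * f x 0 ^ 2) + ε * (U x ^ 2 + |U x| ^ (betaExp N + 2)),
    ((i1.const_mul ε).add (i0.const_mul ε⁻¹)).add ((i1.add i2).const_mul ε), fun x => ?_, ?_⟩
  · refine (abs_mul_le_of_abs_sub_le hβ
      (abs_sub_le_of_abs_deriv_le hε.le hβ (hd x) (h1 x) (U x))).trans ?_
    -- Young's inequality `|U| |f(x,0)| ≤ ε U² + ε⁻¹ f(x,0)²`
    have h4 : |U x| * |f x 0| ≤ ε * U x ^ 2 + ε⁻¹ * f x 0 ^ 2 := by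
      rw [← sq_abs (U x), ← sq_abs (f x 0)]
      have h5 : ε * |U x| ^ 2 + ε⁻¹ * |f x 0| ^ 2 - |U x| * |f x 0| =
          ε⁻¹ * ((ε * |U x| - |f x 0| / 2) ^ 2 + 3 / 4 * |f x 0| ^ 2) := by
        field_simp
        ring
      have h6 : 0 ≤ ε⁻¹ * ((ε * |U x| - |f x 0| / 2) ^ 2 + 3 / 4 * |f x 0| ^ 2) := by positivity
      linarith
    linarith
  · have e : ∫ x, ((ε * U x ^ 2 + ε⁻¹ * f x 0 ^ 2) + ε * (U x ^ 2 + |U x| ^ (betaExp N + 2))) =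
        (ε * (∫ x, U x ^ 2) + ε⁻¹ * ∫ x, f x 0 ^ 2) +
          ε * ((∫ x, U x ^ 2) + ∫ x, |U x| ^ (betaExp N + 2)) := by
      have j1 : Integrable (fun x => ε * U x ^ 2 + ε⁻¹ * f x 0 ^ 2) :=
        (i1.const_mul ε).add (i0.const_mul ε⁻¹)
      have j2 : Integrable (fun x => ε * (U x ^ 2 + |U x| ^ (betaExp N + 2))) :=
        (i1.add i2).const_mul ε
      rw [integral_add j1 j2, integral_add (i1.const_mul ε) (i0.const_mul ε⁻¹), integral_const_mul, integral_const_mul,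
        integral_const_mul, integral_add i1 i2]
    rw [e]
    have a1 := hU.integral_sq_le hN
    have a2 := hU.integral_rpow_beta_le hN
    have a3 : ε⁻¹ * ∫ x, f x 0 ^ 2 ≤ ε := by
      rw [inv_mul_le_iff₀ hε]; linarith [sq ε]
    have a4 := mul_le_mul_of_nonneg_left a1 hε.le
    have a5 := mul_le_mul_of_nonneg_left a2 hε.le
    linarith

/-- A weight between `0` and `1`, supported outside the ball of radius `ρ`. -/
structure IsOuterWeight {N : ℕ} (ρ : ℝ) (φ : E N → ℝ) : Prop where
  meas : Measurable φ
  nonneg : ∀ x, 0 ≤ φ x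
  le_one : ∀ x, φ x ≤ 1
  eq_zero : ∀ x, x ∉ outer N ρ → φ x = 0

lemma IsOuterWeight.integrable_mul {N : ℕ} {ρ : ℝ} {φ f : E N → ℝ} (hφ : IsOuterWeight ρ φ)
    (hf : Integrable f) : Integrable (fun x => φ x * f x) :=
  hf.bdd_mul (c := 1) hφ.meas.aestronglyMeasurable (Eventually.of_forall fun x => by
    rw [Real.norm_of_nonneg (hφ.nonneg x)]; exact hφ.le_one x)

/-- `F(τ,·,0)` is dominated by one `L²` function for `τ` in a bounded interval, and `F'_u` is
uniformly bounded. -/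
lemma exists_growth_bound {N : ℕ} (hN : 3 ≤ N) {F : ℝ → E N → ℝ → ℝ} (h2 : CondH2 F)
    (h3 : CondH3 F) (h4 : CondH4 F) (T : ℝ) :
    ∃ (C : ℝ) (G : E N → ℝ), 0 ≤ C ∧ MemLp G 2 ∧
      (∀ τ x v, |deriv (F τ x) v| ≤ C * (1 + |v| ^ betaExp N)) ∧
      (∀ τ, |τ| ≤ T → ∀ x, |F τ x 0| ≤ G x) ∧
      ∀ τ, |τ| ≤ T → ∀ x v, |v * F τ x v| ≤ |v| * G x + C * (v ^ 2 + |v| ^ (betaExp N + 2)) := by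
  have hβ := (betaExp_facts hN).1
  obtain ⟨C, hC⟩ := h3.growth
  have hC0 : 0 ≤ C := by
    have := (abs_nonneg _).trans (hC 0 0 0)
    simpa [Real.zero_rpow hβ.ne'] using this
  obtain ⟨θ, C', g₀, hθ, -, hC', hg₀, hH⟩ := h4
  have hG : ∀ τ, |τ| ≤ T → ∀ x, |F τ x 0| ≤ |F 0 x 0| + C' * T ^ θ * |g₀ x| := by
    intro τ hτ x
    have a1 := hH τ 0 x 0
    simp only [abs_zero, Real.zero_rpow (by linarith : betaExp N + 1 ≠ 0), add_zero,
      sub_zero] at a1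
    have a2 : C' * g₀ x * |τ| ^ θ ≤ C' * T ^ θ * |g₀ x| := by
      have : |τ| ^ θ ≤ T ^ θ := by gcongr
      have h0 : 0 ≤ |τ| ^ θ := by positivity
      calc C' * g₀ x * |τ| ^ θ ≤ C' * |g₀ x| * |τ| ^ θ := by gcongr; exact le_abs_self _
        _ ≤ C' * |g₀ x| * T ^ θ := by gcongr
        _ = _ := by ring
    have a3 := abs_sub_abs_le_abs_sub (F τ x 0) (F 0 x 0)
    linarith
  by_cases hT : 0 ≤ T
  · refine ⟨C, fun x => |F 0 x 0| + C' * T ^ θ * |g₀ x|, hC0,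
      (h2.memLp 0).abs.add (hg₀.abs.const_mul _), hC, hG,
      fun τ hτ x v => ?_⟩
    refine (abs_mul_le_of_abs_sub_le hβ (abs_sub_le_of_abs_deriv_le hC0 hβ
      ((h3.contDiff τ x).differentiable one_ne_zero) (hC τ x) v)).trans ?_
    gcongr
    exact hG τ hτ x
  · have : ∀ τ : ℝ, ¬ |τ| ≤ T := fun τ h => hT ((abs_nonneg τ).trans h)
    exact ⟨C, 0, hC0, MemLp.zero, hC, fun τ h => absurd h (this τ),
      fun τ h => absurd h (this τ)⟩

lemma measurable_mul_nonlinearity {N : ℕ} {F : ℝ → E N → ℝ → ℝ} (h2 : CondH2 F)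
    {U φ : E N → ℝ} (hU : Measurable U) (hφ : Measurable φ) :
    Measurable (fun z : ℝ × E N => φ z.2 * (U z.2 * F z.1 z.2 (U z.2))) :=
  (hφ.comp measurable_snd).mul ((hU.comp measurable_snd).mul
    (h2.cont.measurable.comp (measurable_fst.prodMk
      (measurable_snd.prodMk (hU.comp measurable_snd)))))

lemma integrable_mul_nonlinearity {N : ℕ} (hN : 3 ≤ N) {F : ℝ → E N → ℝ → ℝ} (h2 : CondH2 F)
    (h3 : CondH3 F) (h4 : CondH4 F) {K : ℝ} {U : E N → ℝ} (hU : SobolevBdd K U) {ρ : ℝ}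
    {φ : E N → ℝ} (hφ : IsOuterWeight ρ φ) (τ : ℝ) :
    Integrable (fun x => φ x * (U x * F τ x (U x))) := by
  obtain ⟨C, G, hC, hG, -, -, hb⟩ := exists_growth_bound hN h2 h3 h4 |τ|
  refine hφ.integrable_mul (((((hU.memLp hN).abs.integrable_mul (q := 2) hG)).add
    (((hU.integrable_sq hN).add (hU.integrable_rpow_beta hN)).const_mul C)).mono' ?_
    (Eventually.of_forall fun x => hb τ le_rfl x (U x)))
  exact (hU.meas.mul (h2.cont.measurable.comp (measurable_const.prodMk
    (measurable_id.prodMk hU.meas)))).aestronglyMeasurable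

/-- The conjugate exponent of an admissible `p` satisfies `q p' ≤ 2^*`. -/
lemma mul_conjExponent_le {N : ℕ} (hN : 3 ≤ N) {p q : ℝ} (hq : 2 ≤ q)
    (hq' : q < 2 * (N : ℝ) / (N - 2)) (hp : 2 * (N : ℝ) / (2 * N - q * (N - 2)) ≤ p) :
    1 < p ∧ q * p.conjExponent ≤ sobolevExp N := by
  have h3 : (3 : ℝ) ≤ N := by exact_mod_cast hN
  have h2 : (0 : ℝ) < N - 2 := by linarith
  rw [lt_div_iff₀ h2] at hq'
  rw [div_le_iff₀ (by linarith)] at hp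
  have hp1 : 1 < p := by
    by_contra h
    have : p * (2 * N - q * (N - 2)) ≤ 1 * (2 * N - q * (N - 2)) :=
      mul_le_mul_of_nonneg_right (not_lt.1 h) (by linarith)
    nlinarith
  refine ⟨hp1, ?_⟩
  unfold Real.conjExponent sobolevExp
  rw [← mul_div_assoc, div_le_div_iff₀ (by linarith) h2]
  nlinarith

/-- The dissipativity condition, integrated against a weight supported in the far field: the
coefficients `b`, `c` contribute only their tails. -/
lemma integral_mul_nonlinearity_le {N : ℕ} (hN : 3 ≤ N) {p q ν : ℝ} (hq : 2 ≤ q)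
    (hp1 : 1 < p) (hpq : q * p.conjExponent ≤ sobolevExp N)
    {F : ℝ → E N → ℝ → ℝ} {b c : ℝ → E N → ℝ} (h2 : CondH2 F) (h3 : CondH3 F) (h4 : CondH4 F)
    (hD : CondD ν p q F b c) {m : ℕ → ℝ} (hm : TailRate p b c m)
    {K : ℝ} {U : E N → ℝ} (hU : SobolevBdd K U) {k : ℕ}
    {φ : E N → ℝ} (hφ : IsOuterWeight k φ) (τ : ℝ) :
    ∫ x, φ x * (U x * F τ x (U x)) ≤ -ν * (∫ x, φ x * U x ^ 2) +
      (m k ^ (1 / p) * K ^ (1 / p.conjExponent) + m k) := by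
  have hconj : p.HolderConjugate p.conjExponent := Real.HolderConjugate.conjExponent hp1
  have hp0 : 0 < p := by linarith
  have hp' : 1 < p.conjExponent := hconj.symm.lt
  have hp0' : 0 < p.conjExponent := by linarith
  have hqp : 2 ≤ q * p.conjExponent := by nlinarith
  have hUq : ∀ x, (|U x| ^ q) ^ p.conjExponent = |U x| ^ (q * p.conjExponent) := fun x =>
    (Real.rpow_mul (abs_nonneg _) _ _).symm
  have mU : MemLp (fun x => |U x| ^ q) (ENNReal.ofReal p.conjExponent) volume := by
    refine (integrable_norm_rpow_iff (f := fun x => |U x| ^ q) ((hU.meas.abs.pow_const q).aestronglyMeasurable)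
      (by simpa using hp0') ENNReal.ofReal_ne_top).1 ?_
    rw [ENNReal.toReal_ofReal hp0'.le]
    refine (hU.integrable _ hqp hpq).congr (Eventually.of_forall fun x => ?_)
    simp only [Real.norm_eq_abs]
    rw [abs_of_nonneg (show 0 ≤ |U x| ^ q by positivity), hUq]
  have mb : MemLp (fun x => |b τ x|) (ENNReal.ofReal p) volume := (hD.ap_b.1 τ).abs
  have mc : Integrable (fun x => |c τ x|) := by
    have := hD.ap_c.1 τ
    rw [ENNReal.ofReal_one, memLp_one_iff_integrable] at this
    exact this.abs
  have ib : Integrable (fun x => |b τ x| * |U x| ^ q) := by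
    have : ENNReal.HolderConjugate (ENNReal.ofReal p) (ENNReal.ofReal p.conjExponent) :=
      hconj.ennrealOfReal
    exact mb.integrable_mul mU
  have tail := hm.tail τ k
  have tb0 : 0 ≤ ∫ x in outer N k, |b τ x| ^ p := integral_nonneg fun x => by positivity
  have tc0 : 0 ≤ ∫ x in outer N k, |c τ x| := integral_nonneg fun x => by positivity
  have tb : ∫ x in outer N k, |b τ x| ^ p ≤ m k := by unfold outer at *; linarith
  have tc : ∫ x in outer N k, |c τ x| ≤ m k := by unfold outer at *; linarith
  have hold : ∫ x in outer N k, |b τ x| * |U x| ^ q ≤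
      m k ^ (1 / p) * K ^ (1 / p.conjExponent) := by
    refine (integral_mul_le_Lp_mul_Lq_of_nonneg hconj
      (Eventually.of_forall fun x => abs_nonneg _)
      (Eventually.of_forall fun x => by positivity) (mb.restrict _) (mU.restrict _)).trans ?_
    have hUK : ∫ x in outer N k, (|U x| ^ q) ^ p.conjExponent ≤ K := by
      simp only [hUq]
      refine le_trans (setIntegral_le_integral (hU.integrable _ hqp hpq)
        (Eventually.of_forall fun x => by positivity)) (hU.bdd _ hqp hpq)
    have := hm.pos k
    gcongr
  have hUi := hφ.integrable_mul (hU.integrable_sq hN)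
  have iind : Integrable ((outer N k).indicator fun x => |b τ x| * |U x| ^ q + |c τ x|) :=
    (ib.add mc).indicator (measurableSet_outer N k)
  calc ∫ x, φ x * (U x * F τ x (U x))
      ≤ ∫ x, (-ν * (φ x * U x ^ 2) +
          (outer N k).indicator (fun x => |b τ x| * |U x| ^ q + |c τ x|) x) := by
        refine integral_mono (integrable_mul_nonlinearity hN h2 h3 h4 hU hφ τ)
          ((hUi.const_mul _).add iind) fun x => ?_
        by_cases hx : x ∈ outer N k
        · simp only [indicator_of_mem hx]
          have d := hD.dissip τ x (U x)
          rw [sq_abs] at d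
          have h5 : b τ x * |U x| ^ q ≤ |b τ x| * |U x| ^ q := by
            gcongr; exact le_abs_self _
          have h6 := le_abs_self (c τ x)
          have h7 : φ x * (U x * F τ x (U x)) ≤
              φ x * (-ν * U x ^ 2 + (|b τ x| * |U x| ^ q + |c τ x|)) :=
            mul_le_mul_of_nonneg_left (by linarith) (hφ.nonneg x)
          have h8 : φ x * (|b τ x| * |U x| ^ q + |c τ x|) ≤ |b τ x| * |U x| ^ q + |c τ x| :=
            mul_le_of_le_one_left (by positivity) (hφ.le_one x)
          linarith
        · simp [indicator_of_notMem hx, hφ.eq_zero x hx]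
    _ = -ν * (∫ x, φ x * U x ^ 2) +
        ((∫ x in outer N k, |b τ x| * |U x| ^ q) + ∫ x in outer N k, |c τ x|) := by
        rw [integral_add (hUi.const_mul _) iind, integral_const_mul,
          integral_indicator (measurableSet_outer N k), integral_add ib.integrableOn mc.integrableOn]
    _ ≤ _ := by linarith

/-! ### Time averages and the nonlinearities of the homotopy -/

/-- The average of `F` over `[-T,T]`. -/
noncomputable def timeAverage {N : ℕ} (F : ℝ → E N → ℝ → ℝ) (T : ℝ) (x : E N) (v : ℝ) : ℝ :=
  (2 * T)⁻¹ * ∫ τ in (-T)..T, F τ x v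

lemma differentiable_timeAverage {N : ℕ} {F : ℝ → E N → ℝ → ℝ} (h2 : CondH2 F)
    (h3 : CondH3 F) {T : ℝ} (x : E N) (hβ : 0 < betaExp N) :
    Differentiable ℝ (timeAverage F T x) := by
  obtain ⟨C, hC⟩ := h3.growth
  have hC0 : 0 ≤ C := by
    have := (abs_nonneg _).trans (hC 0 0 0)
    simpa [Real.zero_rpow hβ.ne'] using this
  intro v₀
  have hcont : Continuous (Function.uncurry fun (τ : ℝ) (v : ℝ) => F τ x v) :=
    h2.cont.comp (continuous_fst.prodMk (continuous_const.prodMk continuous_snd))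
  have hslice : ∀ v, Continuous fun τ => F τ x v := fun v =>
    hcont.comp (continuous_id.prodMk continuous_const)
  have hmeas : Measurable fun τ => deriv (F τ x) v₀ :=
    (measurable_deriv_with_param hcont).comp (measurable_id.prodMk measurable_const)
  have h := intervalIntegral.hasDerivAt_integral_of_dominated_loc_of_deriv_le
    (μ := volume) (a := -T) (b := T) (bound := fun _ => C * (1 + (|v₀| + 1) ^ betaExp N))
    (F := fun v τ => F τ x v) (F' := fun v τ => deriv (F τ x) v) (x₀ := v₀)
    (Metric.ball_mem_nhds v₀ one_pos)
    (Eventually.of_forall fun v => (hslice v).aestronglyMeasurable)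
    ((hslice v₀).intervalIntegrable _ _) hmeas.aestronglyMeasurable
    (Eventually.of_forall fun τ _ v hv => ?_) intervalIntegrable_const
    (Eventually.of_forall fun τ _ v _ =>
      (((h3.contDiff τ x).differentiable one_ne_zero) v).hasDerivAt)
  · exact (h.2.const_mul _).differentiableAt
  · refine (hC τ x v).trans ?_
    have hv' : |v| ≤ |v₀| + 1 := by
      have h1 : |v - v₀| < 1 := hv
      have := abs_sub_abs_le_abs_sub v v₀
      linarith
    gcongr

lemma memLp_timeAverage_zero {N : ℕ} (hN : 3 ≤ N) {F : ℝ → E N → ℝ → ℝ} (h2 : CondH2 F)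
    (h3 : CondH3 F) (h4 : CondH4 F) {T : ℝ} (hT : 0 < T) :
    MemLp (fun x => timeAverage F T x 0) 2 := by
  obtain ⟨C, G, -, hG, -, hb, -⟩ := exists_growth_bound hN h2 h3 h4 T
  refine MemLp.mono hG ?_ (Eventually.of_forall fun x => ?_)
  · have hm : StronglyMeasurable (Function.uncurry fun (x : E N) (τ : ℝ) => F τ x 0) :=
      (h2.cont.comp (continuous_snd.prodMk
        (continuous_fst.prodMk continuous_const))).stronglyMeasurable
    have h := (hm.integral_prod_right (ν := (volume : Measure ℝ).restrict (Ioc (-T) T)))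
    unfold timeAverage
    simp only [intervalIntegral.integral_of_le (by linarith : -T ≤ T)]
    exact (h.const_mul _).aestronglyMeasurable
  · have h1 := intervalIntegral.norm_integral_le_of_norm_le_const (a := -T) (b := T)
      (f := fun τ => F τ x 0) (C := G x) fun τ hτ => by
        rw [uIoc_of_le (by linarith)] at hτ
        exact hb τ (abs_le.2 ⟨hτ.1.le, hτ.2⟩) x
    rw [sub_neg_eq_add, abs_of_pos (by linarith : 0 < T + T)] at h1
    unfold timeAverage
    rw [norm_mul, Real.norm_of_nonneg (by positivity : 0 ≤ (2 * T)⁻¹),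
      inv_mul_le_iff₀ (by positivity)]
    refine h1.trans (le_trans (le_of_eq ?_) (mul_le_mul_of_nonneg_left (le_abs_self (G x))
      (by positivity : 0 ≤ 2 * T)))
    ring

/-- A bound of `∫ φ U F(τ,x,U) dx` which is uniform in `τ` passes to the time averages of `F`. -/
lemma integral_mul_timeAverage_le {N : ℕ} (hN : 3 ≤ N) {F : ℝ → E N → ℝ → ℝ} (h2 : CondH2 F)
    (h3 : CondH3 F) (h4 : CondH4 F) {K : ℝ} {U : E N → ℝ} (hU : SobolevBdd K U) {ρ : ℝ}
    {φ : E N → ℝ} (hφ : IsOuterWeight ρ φ) {M : ℝ}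
    (hM : ∀ τ, ∫ x, φ x * (U x * F τ x (U x)) ≤ M) {T : ℝ} (hT : 0 < T) :
    Integrable (fun x => φ x * (U x * timeAverage F T x (U x))) ∧
      ∫ x, φ x * (U x * timeAverage F T x (U x)) ≤ M := by
  obtain ⟨C, G, -, hG, -, -, hb⟩ := exists_growth_bound hN h2 h3 h4 T
  set μ := (volume : Measure ℝ).restrict (Ioc (-T) T) with hμ
  have hmeas := measurable_mul_nonlinearity h2 hU.meas hφ.meas
  have hdom : Integrable (fun x => |U x| * G x + C * (U x ^ 2 + |U x| ^ (betaExp N + 2))) :=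
    ((hU.memLp hN).abs.integrable_mul (q := 2) hG).add
      (((hU.integrable_sq hN).add (hU.integrable_rpow_beta hN)).const_mul C)
  have hint : Integrable (Function.uncurry fun (τ : ℝ) (x : E N) => φ x * (U x * F τ x (U x)))
      (μ.prod volume) := by
    refine (hdom.comp_snd μ).mono' hmeas.aestronglyMeasurable ?_
    have hae : ∀ᵐ z ∂(μ.prod (volume : Measure (E N))), z.1 ∈ Ioc (-T) T :=
      Measure.quasiMeasurePreserving_fst.ae (ae_restrict_mem measurableSet_Ioc)
    filter_upwards [hae] with z hz
    have h5 := hb z.1 (abs_le.2 ⟨hz.1.le, hz.2⟩) z.2 (U z.2)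
    simp only [Function.uncurry, norm_mul, Real.norm_eq_abs] at h5 ⊢
    rw [abs_of_nonneg (hφ.nonneg z.2), ← abs_mul]
    exact (mul_le_of_le_one_left (abs_nonneg _) (hφ.le_one z.2)).trans h5
  have e : ∀ x, φ x * (U x * timeAverage F T x (U x)) =
      (2 * T)⁻¹ * ∫ τ, φ x * (U x * F τ x (U x)) ∂μ := by
    intro x
    rw [integral_const_mul, integral_const_mul, timeAverage,
      intervalIntegral.integral_of_le (by linarith : -T ≤ T)]
    ring
  simp only [e]
  refine ⟨hint.integral_prod_right.const_mul _, ?_⟩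
  rw [integral_const_mul, ← integral_integral_swap hint, inv_mul_le_iff₀ (by positivity)]
  have h6 := integral_mono (μ := μ) hint.integral_prod_left (integrable_const M) hM
  rw [integral_const, hμ, measureReal_restrict_apply_univ, Real.volume_real_Ioc_of_le
    (by linarith), smul_eq_mul] at h6
  refine h6.trans (le_of_eq ?_)
  ring

/-- The dissipativity bound for the nonlinearities `λ Φ + (1-λ) F̄`. These are limits in `M₂` of
combinations of a translate and a time average of `F`, for which the bound holds with the same
constants. -/
lemma integral_mul_homF_le {N : ℕ} (hN : 3 ≤ N) {a : ℝ → M1 N} {F : ℝ → E N → ℝ → ℝ}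
    (h2 : CondH2 F) (h3 : CondH3 F) (h4 : CondH4 F) {Fbar : E N → ℝ → ℝ} (hbar : IsMeanM2 F Fbar)
    {α : ℝ → M1 N} {Φ : ℝ → E N → ℝ → ℝ} (hull : InHull a F α Φ) {lam : ℝ}
    (hlam : lam ∈ Icc (0 : ℝ) 1) {K : ℝ} {U : E N → ℝ} (hU : SobolevBdd K U)
    {ρ : ℝ} {φ : E N → ℝ} (hφ : IsOuterWeight ρ φ) {M : ℝ}
    (hM : ∀ τ, ∫ x, φ x * (U x * F τ x (U x)) ≤ M) (τ : ℝ)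
    (hint : Integrable fun x => φ x * (U x * homF lam Φ Fbar τ x (U x))) :
    ∫ x, φ x * (U x * homF lam Φ Fbar τ x (U x)) ≤ M := by
  obtain ⟨hl0, hl1⟩ := hlam
  have hl1' : 0 ≤ 1 - lam := by linarith
  have hβ := (betaExp_facts hN).1
  have key : ∀ ε : ℝ, 0 < ε →
      ∫ x, φ x * (U x * homF lam Φ Fbar τ x (U x)) ≤ M + ε * (3 * K + 1) := by
    intro ε hε
    have hε' : 0 < ENNReal.ofReal ε := ENNReal.ofReal_pos.2 hε
    obtain ⟨h, hh⟩ := hull.2 _ hε'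
    obtain ⟨T, hT, hT0⟩ := ((ENNReal.tendsto_nhds_zero.1 hbar.2 _ hε').and
      (eventually_gt_atTop 0)).exists
    obtain ⟨D₁, iD₁, hD₁, bD₁⟩ := exists_majorant_of_m2Norm_le hN hU
      (f := fun x v => Φ τ x v - F (τ + h) x v)
      (fun x => (((hull.1 τ).contDiff x).differentiable one_ne_zero).sub
        ((h3.contDiff _ x).differentiable one_ne_zero))
      ((hull.1 τ).memLp.sub (h2.memLp _)) hε (hh τ).2
    obtain ⟨D₂, iD₂, hD₂, bD₂⟩ := exists_majorant_of_m2Norm_le hN hU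
      (f := fun x v => timeAverage F T x v - Fbar x v)
      (fun x => (differentiable_timeAverage h2 h3 x hβ).sub
        ((hbar.1.contDiff x).differentiable one_ne_zero))
      ((memLp_timeAverage_zero hN h2 h3 h4 hT0).sub hbar.1.memLp) hε hT
    have iF := integrable_mul_nonlinearity hN h2 h3 h4 hU hφ (τ + h)
    obtain ⟨iA, bA⟩ := integral_mul_timeAverage_le hN h2 h3 h4 hU hφ hM hT0
    have j1 := (iF.add iD₁).const_mul lam
    have j2 := (iA.add iD₂).const_mul (1 - lam)
    have hpt : ∀ x, φ x * (U x * homF lam Φ Fbar τ x (U x)) ≤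
        lam * (φ x * (U x * F (τ + h) x (U x)) + D₁ x) +
          (1 - lam) * (φ x * (U x * timeAverage F T x (U x)) + D₂ x) := by
      intro x
      have a1 : φ x * (U x * (Φ τ x (U x) - F (τ + h) x (U x))) ≤ D₁ x :=
        (mul_le_mul_of_nonneg_left (le_abs_self _) (hφ.nonneg x)).trans
          ((mul_le_of_le_one_left (abs_nonneg _) (hφ.le_one x)).trans (hD₁ x))
      have a2 : φ x * -(U x * (timeAverage F T x (U x) - Fbar x (U x))) ≤ D₂ x :=
        (mul_le_mul_of_nonneg_left (neg_le_abs _) (hφ.nonneg x)).trans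
          ((mul_le_of_le_one_left (abs_nonneg _) (hφ.le_one x)).trans (hD₂ x))
      have a3 := mul_le_mul_of_nonneg_left a1 hl0
      have a4 := mul_le_mul_of_nonneg_left a2 hl1'
      unfold homF
      linarith
    have h7 := integral_mono hint (j1.add j2) hpt
    have e : ∫ x, (lam * (φ x * (U x * F (τ + h) x (U x)) + D₁ x) +
          (1 - lam) * (φ x * (U x * timeAverage F T x (U x)) + D₂ x)) =
        lam * ((∫ x, φ x * (U x * F (τ + h) x (U x))) + ∫ x, D₁ x) +
          (1 - lam) * ((∫ x, φ x * (U x * timeAverage F T x (U x))) + ∫ x, D₂ x) := by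
      rw [← integral_add iF iD₁, ← integral_add iA iD₂, ← integral_const_mul,
        ← integral_const_mul]
      exact integral_add j1 j2
    refine h7.trans (e.le.trans ?_)
    have a5 := mul_le_mul_of_nonneg_left (add_le_add (hM (τ + h)) bD₁) hl0
    have a6 := mul_le_mul_of_nonneg_left (add_le_add bA bD₂) hl1'
    linarith
  have hlim : Tendsto (fun ε : ℝ => M + ε * (3 * K + 1)) (𝓝[>] 0) (𝓝 (M + 0 * (3 * K + 1))) :=
    (tendsto_const_nhds.add (tendsto_id.mul_const _)).mono_left nhdsWithin_le_nhds
  rw [zero_mul, add_zero] at hlim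
  exact ge_of_tendsto hlim (eventually_mem_nhdsWithin.mono fun ε hε => key ε hε)

/-! ### The energy estimate in the far field -/

/-- The weight `1 - cutoff`, which is `0` for `‖x‖ ≤ ρ` and `1` for `2 ρ ≤ ‖x‖`. -/
noncomputable def farWeight (N : ℕ) (ρ : ℝ) (x : E N) : ℝ := 1 - cutoff N ρ x

lemma contDiff_farWeight (N : ℕ) (ρ : ℝ) : ContDiff ℝ ∞ (farWeight N ρ) :=
  contDiff_const.sub (contDiff_cutoff N ρ)

lemma isOuterWeight_farWeight {N : ℕ} {ρ r : ℝ} (hρ : 0 < ρ) (hr : r ≤ ρ) :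
    IsOuterWeight r (farWeight N ρ) where
  meas := (contDiff_farWeight N ρ).continuous.measurable
  nonneg x := sub_nonneg.2 (cutoff_le_one N ρ x)
  le_one x := sub_le_self _ (cutoff_nonneg N ρ x)
  eq_zero x hx := by
    simp only [outer, mem_ofPred_eq, not_le] at hx
    rw [farWeight, cutoff_eq_one hρ (by linarith), sub_self]

lemma abs_partialDeriv_farWeight (N : ℕ) (ρ : ℝ) (i : Fin N) (x : E N) :
    |partialDeriv i (farWeight N ρ) x| = |partialDeriv i (cutoff N ρ) x| := by
  have h := (((contDiff_cutoff N ρ).differentiable (by simp)) x).hasFDerivAt.const_sub 1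
  have e : fderiv ℝ (farWeight N ρ) x = -fderiv ℝ (cutoff N ρ) x := h.fderiv
  simp [partialDeriv, e]

/-- The elliptic term, tested with `φ u`: after an integration by parts only the derivatives of
the weight `φ` contribute. -/
lemma sum_integral_weight_le {N : ℕ} {B D R : ℝ} {A : M1 N} (hA : IsBddNonneg B A)
    {u : H1 N} (hu : ‖u‖ ≤ R) {w : Fin N → Fin N → L2 N}
    (hw : ∀ i j, IsWeakPartial j (grad u i) (w i j)) {φ : E N → ℝ} {ρ : ℝ}
    (hφ : IsOuterWeight ρ φ) (hφs : ContDiff ℝ ∞ φ) (hφd : ∀ j x, |partialDeriv j φ x| ≤ D) :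
    ∑ i, ∑ j, A i j * ∫ x, φ x * (toL2 u x * w i j x) ≤ (N : ℝ) ^ 2 * (B * (D * R ^ 2)) := by
  have hR : 0 ≤ R := (norm_nonneg _).trans hu
  have hmul : ∀ {η f : E N → ℝ} {c : ℝ}, Continuous η → (∀ x, |η x| ≤ c) → MemLp f 2 →
      MemLp (fun x => η x * f x) 2 := by
    intro η f c hη hc hf
    exact MemLp.of_le_mul (c := c) hf (hη.aestronglyMeasurable.mul hf.1)
      (Eventually.of_forall fun x => by
        rw [norm_mul]; exact mul_le_mul_of_nonneg_right (hc x) (norm_nonneg _))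
  have hφ1 : ∀ x, |φ x| ≤ 1 := fun x => by
    rw [abs_of_nonneg (hφ.nonneg x)]; exact hφ.le_one x
  have hφdc : ∀ j, Continuous (partialDeriv j φ) := fun j =>
    (contDiff_partialDeriv j hφs).continuous
  have mu : MemLp (toL2 u) 2 := Lp.memLp _
  have mg : ∀ i, MemLp (grad u i) 2 := fun i => Lp.memLp _
  have m1 : ∀ j, MemLp (fun x => φ x * grad u j x) 2 := fun j =>
    hmul hφs.continuous hφ1 (mg j)
  have m2 : ∀ j, MemLp (fun x => partialDeriv j φ x * toL2 u x) 2 := fun j =>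
    hmul (hφdc j) (hφd j) mu
  have i1 : ∀ i j, Integrable (fun x => grad u i x * (φ x * grad u j x)) := fun i j =>
    (mg i).integrable_mul (q := 2) (m1 j)
  have i2 : ∀ i j, Integrable (fun x => grad u i x * (partialDeriv j φ x * toL2 u x)) :=
    fun i j => (mg i).integrable_mul (q := 2) (m2 j)
  have parts : ∀ i j, ∫ x, φ x * (toL2 u x * w i j x) =
      -(∫ x, grad u i x * (φ x * grad u j x)) -
        ∫ x, grad u i x * (partialDeriv j φ x * toL2 u x) := by
    intro i j
    have h := HasWeakPartial.integral_mul (hw i j) (mg i) (Lp.memLp (w i j))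
      (hmul hφs.continuous hφ1 mu) (fun j => (m1 j).add (m2 j))
      (fun j => (hasWeakPartial_toL2 u j).smooth_mul mu (mg j) hφs)
    have e1 : ∫ x, grad u i x * (φ x * grad u j x + partialDeriv j φ x * toL2 u x) =
        (∫ x, grad u i x * (φ x * grad u j x)) +
          ∫ x, grad u i x * (partialDeriv j φ x * toL2 u x) := by
      rw [← integral_add (i1 i j) (i2 i j)]
      simp only [mul_add]
    have e2 : ∫ x, φ x * (toL2 u x * w i j x) = ∫ x, w i j x * (φ x * toL2 u x) := by
      congr 1 with x; ring
    change ∫ x, grad u i x * (φ x * grad u j x + partialDeriv j φ x * toL2 u x) = _ at h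
    rw [e1] at h
    rw [e2]
    linarith
  have ell : 0 ≤ ∑ i, ∑ j, A i j * ∫ x, grad u i x * (φ x * grad u j x) := by
    simp only [← integral_const_mul]
    have hi : ∀ i j, Integrable fun x => A i j * (grad u i x * (φ x * grad u j x)) := fun i j =>
      (i1 i j).const_mul _
    have e : ∑ i, ∑ j, ∫ x, A i j * (grad u i x * (φ x * grad u j x)) =
        ∫ x, ∑ i, ∑ j, A i j * (grad u i x * (φ x * grad u j x)) := by
      rw [integral_finsetSum _ fun i _ => integrable_finsetSum _ fun j _ => hi i j]
      exact Finset.sum_congr rfl fun i _ => (integral_finsetSum _ fun j _ => hi i j).symm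
    rw [e]
    refine integral_nonneg fun x => ?_
    have h := mul_nonneg (hφ.nonneg x) (hA.nonneg fun i => grad u i x)
    refine h.trans (le_of_eq ?_)
    simp only [Finset.mul_sum]
    refine Finset.sum_congr rfl fun i _ => Finset.sum_congr rfl fun j _ => ?_
    ring
  have cross : ∀ i j, |∫ x, grad u i x * (partialDeriv j φ x * toL2 u x)| ≤ D * R ^ 2 := by
    intro i j
    have hD : 0 ≤ D := (abs_nonneg _).trans (hφd j 0)
    have hsq : ∀ f : L2 N, ‖f‖ ≤ ‖u‖ → ∫ x, f x ^ 2 ≤ R ^ 2 := by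
      intro f hf
      rw [integral_sq_eq_norm_sq]
      have := hf.trans hu
      gcongr
    have j1 := integrable_sq_L2 (grad u i)
    have j2 := integrable_sq_L2 (toL2 u)
    have h := norm_integral_le_of_norm_le ((j1.add j2).const_mul (D / 2))
      (f := fun x => grad u i x * (partialDeriv j φ x * toL2 u x))
      (Eventually.of_forall fun x => by
        rw [Real.norm_eq_abs, abs_mul, abs_mul]
        have h1 : |grad u i x| * |toL2 u x| ≤ (grad u i x ^ 2 + toL2 u x ^ 2) / 2 := by
          rw [← sq_abs (grad u i x), ← sq_abs (toL2 u x)]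
          linarith [sq_nonneg (|grad u i x| - |toL2 u x|),
            sub_sq |grad u i x| |toL2 u x|]
        calc |grad u i x| * (|partialDeriv j φ x| * |toL2 u x|)
            = |partialDeriv j φ x| * (|grad u i x| * |toL2 u x|) := by ring
          _ ≤ D * ((grad u i x ^ 2 + toL2 u x ^ 2) / 2) := by
              gcongr; exact hφd j x
          _ = D / 2 * (grad u i x ^ 2 + toL2 u x ^ 2) := by ring)
    have e : ∫ x, D / 2 * (grad u i x ^ 2 + toL2 u x ^ 2) =
        D / 2 * ((∫ x, grad u i x ^ 2) + ∫ x, toL2 u x ^ 2) := by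
      rw [integral_const_mul, integral_add j1 j2]
    refine h.trans (e.le.trans ?_)
    have a1 := hsq _ (norm_grad_le u i)
    have a2 := hsq _ (norm_toL2_le u)
    calc D / 2 * ((∫ x, grad u i x ^ 2) + ∫ x, toL2 u x ^ 2) ≤ D / 2 * (R ^ 2 + R ^ 2) := by
          gcongr
      _ = D * R ^ 2 := by ring
  have hterm : ∀ i j, A i j * ∫ x, φ x * (toL2 u x * w i j x) ≤
      -(A i j * ∫ x, grad u i x * (φ x * grad u j x)) + B * (D * R ^ 2) := by
    intro i j
    have h1 : |A i j * ∫ x, grad u i x * (partialDeriv j φ x * toL2 u x)| ≤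
        B * (D * R ^ 2) := by
      rw [abs_mul]
      exact mul_le_mul (hA.bdd i j) (cross i j) (abs_nonneg _)
        ((abs_nonneg _).trans (hA.bdd i j))
    rw [parts i j]
    have := neg_abs_le (A i j * ∫ x, grad u i x * (partialDeriv j φ x * toL2 u x))
    linarith
  calc ∑ i, ∑ j, A i j * ∫ x, φ x * (toL2 u x * w i j x)
      ≤ ∑ i, ∑ j, (-(A i j * ∫ x, grad u i x * (φ x * grad u j x)) + B * (D * R ^ 2)) :=
        Finset.sum_le_sum fun i _ => Finset.sum_le_sum fun j _ => hterm i j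
    _ = -(∑ i, ∑ j, A i j * ∫ x, grad u i x * (φ x * grad u j x)) +
        (N : ℝ) ^ 2 * (B * (D * R ^ 2)) := by
        simp only [Finset.sum_add_distrib, Finset.sum_neg_distrib, Finset.sum_const,
          Finset.card_univ, Fintype.card_fin, nsmul_eq_mul]
        ring
    _ ≤ _ := by linarith

/-- Multiplication by a bounded measurable weight is a bounded operator on `L²`. -/
lemma exists_mulL2 {N : ℕ} {ρ : ℝ} {φ : E N → ℝ} (hφ : IsOuterWeight ρ φ) :
    ∃ M : L2 N →L[ℝ] L2 N, ∀ f : L2 N, M f =ᵐ[volume] fun x => φ x * f x := by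
  have hm : MemLp φ ⊤ (volume : Measure (E N)) :=
    memLp_top_of_bound hφ.meas.aestronglyMeasurable 1 (Eventually.of_forall fun x => by
      rw [Real.norm_of_nonneg (hφ.nonneg x)]; exact hφ.le_one x)
  refine ⟨(ContinuousLinearMap.mul ℝ ℝ).holderL volume ⊤ 2 2 (hm.toLp φ), fun f => ?_⟩
  filter_upwards [(ContinuousLinearMap.mul ℝ ℝ).coeFn_holder (r := 2) (hm.toLp φ) f,
    hm.coeFn_toLp] with x h1 h2
  refine h1.trans ?_
  simp [h2]

/-- The derivative of the weighted energy `∫ φ u²`. -/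
lemma hasDerivAt_weighted_energy {N : ℕ} {ρ : ℝ} {φ : E N → ℝ} (hφ : IsOuterWeight ρ φ)
    {f : ℝ → L2 N} {v : L2 N} {t : ℝ} (hf : HasDerivAt f v t) :
    HasDerivAt (fun r => ∫ x, φ x * f r x ^ 2) (2 * ∫ x, φ x * (f t x * v x)) t := by
  obtain ⟨M, hM⟩ := exists_mulL2 hφ
  have key : ∀ g h : L2 N, inner ℝ (M g) h = ∫ x, φ x * (g x * h x) := by
    intro g h
    rw [L2.inner_def]
    refine integral_congr_ae ?_
    filter_upwards [hM g] with x hx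
    rw [hx]
    simp only [RCLike.inner_apply, conj_trivial]
    ring
  have hd := ((M.hasFDerivAt (x := f t)).comp_hasDerivAt t hf).inner ℝ hf
  have e : (fun r => ∫ x, φ x * f r x ^ 2) = fun r => inner ℝ ((M ∘ f) r) (f r) := by
    ext r
    rw [Function.comp_apply, key]
    congr 1 with x
    ring
  rw [e]
  refine hd.congr_deriv ?_
  rw [Function.comp_apply, key, key, two_mul]
  congr 2 with x
  ring

lemma continuousOn_weighted_energy {N : ℕ} {ρ : ℝ} {φ : E N → ℝ} (hφ : IsOuterWeight ρ φ)
    {f : ℝ → L2 N} {I : Set ℝ} (hf : ContinuousOn f I) :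
    ContinuousOn (fun r => ∫ x, φ x * f r x ^ 2) I := by
  obtain ⟨M, hM⟩ := exists_mulL2 hφ
  have e : (fun r => ∫ x, φ x * f r x ^ 2) = fun r => inner ℝ (M (f r)) (f r) := by
    ext r
    rw [L2.inner_def]
    refine integral_congr_ae ?_
    filter_upwards [hM (f r)] with x hx
    rw [hx]
    simp only [RCLike.inner_apply, conj_trivial]
    ring
  rw [e]
  exact (M.continuous.comp_continuousOn hf).inner hf

/-- Gronwall's inequality for `y' ≤ -κ y + d`. -/
lemma gronwall_decay {y y' : ℝ → ℝ} {s T κ d : ℝ} (hκ : 0 < κ) (hd : 0 ≤ d)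
    (hy : ContinuousOn y (Icc s (s + T))) (hy' : ∀ t ∈ Ioo s (s + T), HasDerivAt y (y' t) t)
    (hle : ∀ t ∈ Ioo s (s + T), y' t ≤ -κ * y t + d) {t : ℝ} (ht : t ∈ Icc s (s + T)) :
    y t ≤ y s * Real.exp (-κ * (t - s)) + d / κ := by
  have hder : ∀ r ∈ Ioo s (s + T), HasDerivAt (fun r => Real.exp (κ * (r - s)) * (y r - d / κ))
      (Real.exp (κ * (r - s)) * (κ * 1) * (y r - d / κ) + Real.exp (κ * (r - s)) * y' r) r := by
    intro r hr
    exact ((((hasDerivAt_id r).sub_const s).const_mul κ).exp).mul ((hy' r hr).sub_const _)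
  have hanti : AntitoneOn (fun r => Real.exp (κ * (r - s)) * (y r - d / κ)) (Icc s (s + T)) := by
    refine antitoneOn_of_deriv_nonpos (convex_Icc _ _) ?_ ?_ ?_
    · exact (by fun_prop : Continuous fun r => Real.exp (κ * (r - s))).continuousOn.mul
        (hy.sub continuousOn_const)
    · rw [interior_Icc]
      exact fun r hr => (hder r hr).differentiableAt.differentiableWithinAt
    · rw [interior_Icc]
      intro r hr
      rw [(hder r hr).deriv]
      have h1 : Real.exp (κ * (r - s)) * (κ * 1) * (y r - d / κ) +
          Real.exp (κ * (r - s)) * y' r = Real.exp (κ * (r - s)) * (y' r + κ * y r - d) := by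
        field_simp
        ring
      rw [h1]
      exact mul_nonpos_of_nonneg_of_nonpos (Real.exp_pos _).le (by linarith [hle r hr])
  have h := hanti ⟨le_rfl, ht.1.trans ht.2⟩ ht ht.1
  simp only [sub_self, mul_zero, Real.exp_zero, one_mul] at h
  have h2 := mul_le_mul_of_nonneg_left h (Real.exp_pos (-κ * (t - s))).le
  rw [← mul_assoc, ← Real.exp_add, neg_mul, neg_add_cancel, Real.exp_zero, one_mul] at h2
  have h3 : 0 ≤ Real.exp (-(κ * (t - s))) * (d / κ) := by positivity
  rw [neg_mul]
  linarith

/-- The energy estimate: if the reaction term is at most `-ν ∫ φ u² + δ`, then `∫ φ u²` decays with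
rate `2ν` up to the contributions of `∇φ` and `δ`. The reaction bound is asked for only where the
integrand is integrable, which the equation provides. -/
lemma IsSolution.weighted_energy_le {N : ℕ} {A : ℝ → M1 N} {G : ℝ → E N → ℝ → ℝ}
    {κ s T : ℝ} {u : ℝ → H1 N} (hsol : IsSolution A G κ s T u) {B D R ν δ ρ : ℝ}
    (hν : 0 < ν) (hδ : 0 ≤ δ) (hB : 0 ≤ B) (hD : 0 ≤ D)
    (hA : ∀ τ, IsBddNonneg B (A τ)) (hu : ∀ t ∈ Icc s (s + T), ‖u t‖ ≤ R)
    {φ : E N → ℝ} (hφ : IsOuterWeight ρ φ) (hφs : ContDiff ℝ ∞ φ)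
    (hφd : ∀ j x, |partialDeriv j φ x| ≤ D)
    (hG : ∀ t ∈ Icc s (s + T), ∀ τ,
      Integrable (fun x => φ x * (toL2 (u t) x * G τ x (toL2 (u t) x))) →
      ∫ x, φ x * (toL2 (u t) x * G τ x (toL2 (u t) x)) ≤
        -ν * (∫ x, φ x * toL2 (u t) x ^ 2) + δ)
    {t : ℝ} (ht : t ∈ Icc s (s + T)) :
    ∫ x, φ x * toL2 (u t) x ^ 2 ≤ R ^ 2 * Real.exp (-2 * ν * (t - s)) +
      ((N : ℝ) ^ 2 * (B * (D * R ^ 2)) + δ) / ν := by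
  obtain ⟨v, -, hv⟩ := hsol.eqn
  have hcont : ContinuousOn (fun r => toL2 (u r)) (Icc s (s + T)) := by
    have : Continuous (toL2 : H1 N → L2 N) :=
      (WithLp.prod_continuous_ofLp 2 _ _).fst.comp continuous_subtype_val
    exact this.comp_continuousOn hsol.cont
  have hgr := gronwall_decay (κ := 2 * ν) (d := 2 * ((N : ℝ) ^ 2 * (B * (D * R ^ 2)) + δ))
    (by positivity) (by positivity) (continuousOn_weighted_energy hφ hcont)
    (fun r hr => hasDerivAt_weighted_energy hφ (hv r hr).1) (fun r hr => ?_) ht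
  · have hs : ∫ x, φ x * toL2 (u s) x ^ 2 ≤ R ^ 2 := by
      have hsm : s ∈ Icc s (s + T) := ⟨le_rfl, ht.1.trans ht.2⟩
      refine (integral_mono (hφ.integrable_mul (integrable_sq_L2 _)) (integrable_sq_L2 _)
        fun x => mul_le_of_le_one_left (sq_nonneg _) (hφ.le_one x)).trans ?_
      rw [integral_sq_eq_norm_sq]
      have := (norm_toL2_le (u s)).trans (hu s hsm)
      gcongr
    refine hgr.trans ?_
    rw [mul_div_mul_left _ _ two_ne_zero, neg_mul_eq_neg_mul]
    gcongr
  · have hrI : r ∈ Icc s (s + T) := Ioo_subset_Icc_self hr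
    obtain ⟨-, w, hw, heq⟩ := hv r hr
    have hprod : ∀ z : L2 N, Integrable (fun x => φ x * (toL2 (u r) x * z x)) := fun z =>
      hφ.integrable_mul ((Lp.memLp (toL2 (u r))).integrable_mul (q := 2) (Lp.memLp z))
    have isum : Integrable (fun x => ∑ i, ∑ j,
        A (κ * r) i j * (φ x * (toL2 (u r) x * w i j x))) :=
      integrable_finsetSum _ fun i _ => integrable_finsetSum _ fun j _ =>
        (hprod (w i j)).const_mul _
    have hae : (fun x => φ x * (toL2 (u r) x * v r x) - ∑ i, ∑ j,
        A (κ * r) i j * (φ x * (toL2 (u r) x * w i j x))) =ᵐ[volume]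
        fun x => φ x * (toL2 (u r) x * G (κ * r) x (toL2 (u r) x)) := by
      filter_upwards [heq] with x hx
      rw [← hx, mul_sub, mul_sub, Finset.mul_sum, Finset.mul_sum]
      congr 1
      refine Finset.sum_congr rfl fun i _ => ?_
      rw [Finset.mul_sum, Finset.mul_sum]
      exact Finset.sum_congr rfl fun j _ => by ring
    have iG := ((hprod (v r)).sub isum).congr hae
    have h1 := hG r hrI (κ * r) iG
    rw [← integral_congr_ae hae, integral_sub (hprod (v r)) isum,
      integral_finsetSum _ fun i _ => integrable_finsetSum _ fun j _ =>
        (hprod (w i j)).const_mul _] at h1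
    have h2 : ∑ i, ∫ x, ∑ j, A (κ * r) i j * (φ x * (toL2 (u r) x * w i j x)) =
        ∑ i, ∑ j, A (κ * r) i j * ∫ x, φ x * (toL2 (u r) x * w i j x) := by
      refine Finset.sum_congr rfl fun i _ => ?_
      rw [integral_finsetSum _ fun j _ => (hprod (w i j)).const_mul _]
      exact Finset.sum_congr rfl fun j _ => integral_const_mul _ _
    rw [h2] at h1
    have h3 := sum_integral_weight_le (hA (κ * r)) (hu r hrI) hw hφ hφs hφd
    linarith

end APParabolic

open APParabolic in
theorem proposition3p2 (N : ℕ) (hN : 3 ≤ N) (p q : ℝ) (hq : 2 ≤ q)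
    (hq' : q < 2 * (N : ℝ) / (N - 2)) (hp : 2 * (N : ℝ) / (2 * N - q * (N - 2)) ≤ p) :
    -- decay rates exist for all admissible coefficients `b`, `c`
    (∀ b c : ℝ → APParabolic.E N → ℝ, APParabolic.APLp p b → APParabolic.APLp 1 c →
      ∃ m : ℕ → ℝ, APParabolic.TailRate p b c m) ∧
    -- the tail estimate, with `η` depending on `R`, `ν`, `ν₀` and `m` only
    (∀ R ν ν₀ : ℝ, 0 < R → 0 < ν → 0 < ν₀ →
      ∀ m : ℕ → ℝ, (∀ k, 0 < m k) → Tendsto m atTop (𝓝 0) →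
      ∃ η : ℕ → ℝ, Tendsto η atTop (𝓝 0) ∧
        ∀ (a : ℝ → APParabolic.M1 N) (F : ℝ → APParabolic.E N → ℝ → ℝ)
          (b c : ℝ → APParabolic.E N → ℝ),
          APParabolic.CondH1 ν₀ a → APParabolic.CondH2 F → APParabolic.CondH3 F →
          APParabolic.CondH4 F → APParabolic.CondAP a F →
          APParabolic.CondD ν p q F b c → APParabolic.TailRate p b c m →
        ∀ (abar : APParabolic.M1 N) (Fbar : APParabolic.E N → ℝ → ℝ),
          APParabolic.IsMeanM1 a abar → APParabolic.IsMeanM2 F Fbar →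
        ∀ (lam ω : ℝ), lam ∈ Icc (0 : ℝ) 1 → 0 < ω →
        ∀ (α : ℝ → APParabolic.M1 N) (Φ : ℝ → APParabolic.E N → ℝ → ℝ),
          APParabolic.InHull a F α Φ →
        ∀ (s T : ℝ) (u : ℝ → APParabolic.H1 N), 0 < T →
          APParabolic.IsSolution (APParabolic.homA lam α abar) (APParabolic.homF lam Φ Fbar)
            ω s T u →
          (∀ t ∈ Icc s (s + T), ‖u t‖ ≤ R) →
          ∀ t ∈ Icc s (s + T), ∀ k : ℕ,
            ∫ x in {x : APParabolic.E N | (k : ℝ) ≤ ‖x‖}, (APParabolic.toL2 (u t) x) ^ 2 ≤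
              R ^ 2 * Real.exp (-2 * ν * (t - s)) + η k) := by
  obtain ⟨hp1, hpq⟩ := mul_conjExponent_le hN hq hq' hp
  refine ⟨fun b c hb hc => exists_tailRate hp1.le hb hc, ?_⟩
  intro R ν ν₀ hR hν hν₀ m hm0 hm
  obtain ⟨K, hK, hKu⟩ := exists_sobolevBdd hN hR.le
  obtain ⟨C, hC, hCφ⟩ := exists_partialDeriv_cutoff_le N
  -- the weight for the tail beyond `k` has `ρ = k/2`; its support meets the tail of `b`, `c`
  -- beyond the integer part of `k/2` only
  set δ : ℕ → ℝ := fun j => m j ^ (1 / p) * K ^ (1 / p.conjExponent) + m j with hδ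
  have hδ0 : ∀ j, 0 ≤ δ j := fun j => by have := hm0 j; positivity
  have hδlim : Tendsto δ atTop (𝓝 0) := by
    have hp' : 0 < 1 / p := by positivity
    have h := ((hm.rpow_const (p := 1 / p) (Or.inr hp'.le)).mul_const
      (K ^ (1 / p.conjExponent))).add hm
    rwa [Real.zero_rpow hp'.ne', zero_mul, add_zero] at h
  refine ⟨fun k => (if k = 0 then R ^ 2 else 0) +
    ((N : ℝ) ^ 2 * (ν₀⁻¹ * (C / ((k : ℝ) / 2) * R ^ 2)) + δ (k / 2)) / ν, ?_, ?_⟩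
  · have h1 : Tendsto (fun k : ℕ => if k = 0 then R ^ 2 else 0) atTop (𝓝 0) :=
      tendsto_const_nhds.congr' ((eventually_gt_atTop 0).mono fun k hk => by simp [hk.ne'])
    have h2 : Tendsto (fun k : ℕ => C / ((k : ℝ) / 2)) atTop (𝓝 0) :=
      tendsto_const_nhds.div_atTop (tendsto_natCast_atTop_atTop.atTop_div_const two_pos)
    have h3 : Tendsto (fun k : ℕ => δ (k / 2)) atTop (𝓝 0) :=
      hδlim.comp (Nat.tendsto_div_const_atTop two_ne_zero)
    have h := h1.add (((((h2.mul_const (R ^ 2)).const_mul ν₀⁻¹).const_mul ((N : ℝ) ^ 2)).add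
      h3).div_const ν)
    simpa using h
  intro a F b c hH1 hH2 hH3 hH4 _ hD htail abar Fbar habar hFbar lam ω hlam _ α Φ hull s T u _
    hsol hu t ht k
  rcases Nat.eq_zero_or_pos k with rfl | hk
  · have h1 : ∫ x in {x : E N | ((0 : ℕ) : ℝ) ≤ ‖x‖}, toL2 (u t) x ^ 2 ≤ R ^ 2 := by
      refine (setIntegral_le_integral (integrable_sq_L2 _)
        (Eventually.of_forall fun x => sq_nonneg _)).trans ?_
      rw [integral_sq_eq_norm_sq]
      have := (norm_toL2_le (u t)).trans (hu t ht)
      gcongr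
    have h2 := hδ0 (0 / 2)
    have h3 : 0 ≤ R ^ 2 * Real.exp (-2 * ν * (t - s)) := by positivity
    have h4 : 0 ≤ ((N : ℝ) ^ 2 * (ν₀⁻¹ * (C / (((0 : ℕ) : ℝ) / 2) * R ^ 2)) + δ (0 / 2)) / ν := by
      positivity
    simp only [if_true]
    exact h1.trans (le_add_of_nonneg_of_le h3 (le_add_of_nonneg_right h4))
  have hk0 : (0 : ℝ) < k := by exact_mod_cast hk
  have hρ : (0 : ℝ) < (k : ℝ) / 2 := by positivity
  have hφ : IsOuterWeight ((k / 2 : ℕ) : ℝ) (farWeight N ((k : ℝ) / 2)) :=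
    isOuterWeight_farWeight hρ Nat.cast_div_le
  have main := hsol.weighted_energy_le (B := ν₀⁻¹) (D := C / ((k : ℝ) / 2)) (R := R)
    (δ := δ (k / 2)) hν (hδ0 _) (by positivity) (by positivity)
    (fun τ => (hull.isBddNonneg hν₀ hH1 τ).convex (habar.isBddNonneg hν₀ hH1) hlam) hu hφ
    (contDiff_farWeight N _)
    (fun j x => (abs_partialDeriv_farWeight N _ j x).trans_le (hCφ _ hρ j x))
    (fun r hr τ hint => integral_mul_homF_le hN hH2 hH3 hH4 hFbar hull hlam (hKu _ (hu r hr)) hφ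
      (fun τ' => integral_mul_nonlinearity_le hN hq hp1 hpq hH2 hH3 hH4 hD htail
        (hKu _ (hu r hr)) hφ τ') τ hint) ht
  have htl : ∫ x in outer N k, toL2 (u t) x ^ 2 ≤
      ∫ x, farWeight N ((k : ℝ) / 2) x * toL2 (u t) x ^ 2 := by
    rw [← integral_indicator (measurableSet_outer N k)]
    refine integral_mono ((integrable_sq_L2 _).indicator (measurableSet_outer N k))
      (hφ.integrable_mul (integrable_sq_L2 _)) fun x => ?_
    by_cases hx : x ∈ outer N k
    · have hx' : 2 * ((k : ℝ) / 2) ≤ ‖x‖ := by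
        have : (k : ℝ) ≤ ‖x‖ := hx
        linarith
      simp [indicator_of_mem hx, farWeight, cutoff_eq_zero hρ hx']
    · rw [indicator_of_notMem hx]
      exact mul_nonneg (hφ.nonneg x) (sq_nonneg _)
  simp only [hk.ne', if_false, zero_add]
  exact htl.trans main
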